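/- Let $d$ be a natural number and let $C=(c_{ij})$ be a $d\times d$-matrix of real-valued functions $c_{ij}\in L_\infty(\mathbf R^d)$ such that $C(x)$ is symmetric and positive-semidefinite for almost every $x\in\mathbf R^d$. Let $\partial_i$ denote the (distributional) partial derivative in the $i$-th coordinate, viewed as an operator on the complex Hilbert space $L_2(\mathbf R^d)$, and set $W^{1,2}(\mathbf R^d)=\bigcap_{i=1}^d D(\partial_i)$. Define the positive quadratic forms $$h(\varphi)=\sum_{i,j=1}^d\int_{\mathbf R^d}\overline{(\partial_i\varphi)(x)}\,c_{ij}(x)\,(\partial_j\varphi)(x)\,dx,\qquad l(\varphi)=\sum_{i=1}^d\|\partial_i\varphi\|_2^2,$$ with domains $D(h)=D(l)=W^{1,2}(\mathbf R^d)$, and let $\Delta=-\sum_{i=1}^d\partial_i^2$ be the positive self-adjoint Laplacian, i.e. the operator associated with $l$. For $\varepsilon>0$ let $H_\varepsilon$ be the positive self-adjoint operator associated with the closed form $h_\varepsilon=h+\varepsilon\, l$, $D(h_\varepsilon)=W^{1,2}(\mathbf R^d)$. Let $H_0$, the viscosity operator with coefficients $C$, be the positive self-adjoint operator which is the limit of $H_\varepsilon$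 in the strong resolvent sense as $\varepsilon\downarrow0$. With each positive self-adjoint operator $A$ is associated the form $\varphi\mapsto\|A^{1/2}\varphi\|_2^2$ with domain $D(A^{1/2})$; let $h_0$ be the form associated with $H_0$. For quadratic forms $a,b$ write $a\ge b$ if $D(a)\subseteq D(b)$ and $a(\varphi)\ge b(\varphi)$ for all $\varphi\in D(a)$; an inequality between operators in the quadratic form sense is this inequality between the associated forms, and $I$ denotes the identity, with form $\varphi\mapsto\|\varphi\|_2^2$. The following conditions are equivalent. 1. The form $h$ is closed. 2. $h=h_0$ (with equality of domains). 3. There is a $\mu>0$ such that $C(x)\ge\mu I$ for almost every $x\in\mathbf R^d$. 4. There is a $\mu>0$ such that $h\ge\mu\, l$. 5. There are $\mu>0$ and $\nu\ge0$ such that $h\ge\mu\, l-\nu I$. 6. There is a $\mu>0$ such that $H_0\ge\mu\,\Delta$ in the quadratic form sense. 7. There are $\mu>0$ and $\nu\ge0$ such that $H_0\ge\mu\,\Delta-\nu I$ in the quadratic form sense. -/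

import Mathlib

open MeasureTheory Filter Topology
open scoped ENNReal ComplexConjugate SchwartzMap LineDeriv

noncomputable section

namespace Viscosity

/-! ### Quadratic forms on a complex Hilbert space -/

section Abstract

variable {𝓗 : Type*} [NormedAddCommGroup 𝓗] [InnerProductSpace ℂ 𝓗]

/-- A quadratic form on a complex Hilbert space, given by its domain (a subspace) and its
sesquilinear form, antilinear in the first and linear in the second variable. -/
structure Form (𝓗 : Type*) [NormedAddCommGroup 𝓗] [InnerProductSpace ℂ 𝓗] where
  /-- the domain `D(a)` -/
  domain : Submodule ℂ 𝓗
  /-- the sesquilinear form `a(φ, ψ)` -/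
  sesq : domain →ₗ⋆[ℂ] domain →ₗ[ℂ] ℂ

/-- The sesquilinear map `(φ, ψ) ↦ B(Tφ, Tψ)`. -/
def pullback {M N : Type*} [AddCommGroup M] [Module ℂ M] [AddCommGroup N] [Module ℂ N]
    (B : N →ₗ⋆[ℂ] N →ₗ[ℂ] ℂ) (T : M →ₗ[ℂ] N) : M →ₗ⋆[ℂ] M →ₗ[ℂ] ℂ :=
  LinearMap.mk₂'ₛₗ (starRingEnd ℂ) (RingHom.id ℂ) (fun φ ψ => B (T φ) (T ψ))
    (by intros; simp) (by intros; simp) (by intros; simp) (by intros; simp)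

namespace Form

/-- The value `a(φ) = a(φ, φ)`; it is real for the symmetric forms that occur below. -/
def value (a : Form 𝓗) (φ : a.domain) : ℝ := (a.sesq φ φ).re

/-- The form of the identity operator, `φ ↦ ‖φ‖²`. -/
def ident : Form 𝓗 where
  domain := ⊤
  sesq := pullback (innerₛₗ ℂ) (Submodule.subtype ⊤)

/-- Sum of forms, on the intersection of the domains. -/
instance : Add (Form 𝓗) where
  add a b :=
    { domain := a.domain ⊓ b.domain
      sesq := pullback a.sesq (Submodule.inclusion inf_le_left)
        + pullback b.sesq (Submodule.inclusion inf_le_right) }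

/-- Real multiple of a form, on the same domain. -/
instance : SMul ℝ (Form 𝓗) where
  smul r a := { domain := a.domain, sesq := (r : ℂ) • a.sesq }

/-- Difference of forms, on the intersection of the domains. -/
instance : Sub (Form 𝓗) where
  sub a b := a + (-1 : ℝ) • b

/-- The order of forms: `b ≤ a` if `D(a) ⊆ D(b)` and `b(φ) ≤ a(φ)` for all `φ ∈ D(a)`. -/
instance : LE (Form 𝓗) where
  le b a := ∃ hd : a.domain ≤ b.domain, ∀ φ : a.domain, b.value ⟨φ, hd φ.2⟩ ≤ a.value φ

/-- A positive form is closed if, whenever `φₙ ∈ D(a)`, `φₙ → φ` and `a(φₙ - φₘ) → 0`, one has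
`φ ∈ D(a)` and `a(φₙ - φ) → 0`. -/
def IsClosed (a : Form 𝓗) : Prop :=
  ∀ (u : ℕ → a.domain) (φ : 𝓗), Tendsto (fun n => (u n : 𝓗)) atTop (𝓝 φ) →
    Tendsto (fun p : ℕ × ℕ => a.value (u p.1 - u p.2)) atTop (𝓝 0) →
    ∃ hφ : φ ∈ a.domain, Tendsto (fun n => a.value (u n - ⟨φ, hφ⟩)) atTop (𝓝 0)

/-- The graph of the operator associated with a form: all `(φ, f)` with `φ ∈ D(a)` and
`a(ψ, φ) = (ψ, f)` for all `ψ ∈ D(a)`. -/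
def operatorGraph (a : Form 𝓗) : Submodule ℂ (𝓗 × 𝓗) where
  carrier := {p | ∃ hp : p.1 ∈ a.domain, ∀ ψ : a.domain,
    a.sesq ψ ⟨p.1, hp⟩ = inner ℂ (ψ : 𝓗) p.2}
  zero_mem' := ⟨a.domain.zero_mem, fun ψ => by
    have : (⟨0, a.domain.zero_mem⟩ : a.domain) = 0 := rfl
    simp [this]⟩
  add_mem' := by
    rintro ⟨x, f⟩ ⟨y, g⟩ ⟨hx, hf⟩ ⟨hy, hg⟩
    refine ⟨a.domain.add_mem hx hy, fun ψ => ?_⟩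
    have : (⟨x + y, a.domain.add_mem hx hy⟩ : a.domain) = ⟨x, hx⟩ + ⟨y, hy⟩ := rfl
    exact (congrArg (a.sesq ψ) this).trans <| (map_add _ _ _).trans <|
      (congrArg₂ (· + ·) (hf ψ) (hg ψ)).trans (inner_add_right _ _ _).symm
  smul_mem' := by
    rintro c ⟨x, f⟩ ⟨hx, hf⟩
    refine ⟨a.domain.smul_mem c hx, fun ψ => ?_⟩
    have : (⟨c • x, a.domain.smul_mem c hx⟩ : a.domain) = c • ⟨x, hx⟩ := rfl
    exact (congrArg (a.sesq ψ) this).trans <| (map_smul _ _ _).trans <|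
      (congrArg (c * ·) (hf ψ)).trans (inner_smul_right _ _ _).symm

/-- The operator associated with a (densely defined) form. -/
def operator (a : Form 𝓗) : 𝓗 →ₗ.[ℂ] 𝓗 := a.operatorGraph.toLinearPMap

end Form

variable [CompleteSpace 𝓗]

/-- `S` is the positive self-adjoint square root of `A`: `S` is self-adjoint, `S ≥ 0`, and
`S ∘ S = A`, with equality of domains. -/
def IsPositiveSqrt (S A : 𝓗 →ₗ.[ℂ] 𝓗) : Prop :=
  IsSelfAdjoint S ∧ (∀ φ : S.domain, 0 ≤ (inner ℂ (φ : 𝓗) (S φ)).re) ∧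
    ∀ φ f : 𝓗, (φ, f) ∈ A.graph ↔ ∃ ψ, (φ, ψ) ∈ S.graph ∧ (ψ, f) ∈ S.graph

open Classical in
/-- The square root `A^{1/2}` of a positive self-adjoint operator `A` (which exists and is unique;
the value for other `A` is irrelevant). -/
def opSqrt (A : 𝓗 →ₗ.[ℂ] 𝓗) : 𝓗 →ₗ.[ℂ] 𝓗 :=
  if h : ∃ S, IsPositiveSqrt S A then h.choose else 0

/-- The form associated with a positive self-adjoint operator `A`: its domain is `D(A^{1/2})` and
its value is `‖A^{1/2} φ‖²`. -/
def formOf (A : 𝓗 →ₗ.[ℂ] 𝓗) : Form 𝓗 where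
  domain := (opSqrt A).domain
  sesq := pullback (innerₛₗ ℂ) (opSqrt A).toFun

/-- The graph of the strong resolvent limit `A₀` of `A_ε` as `ε ↓ 0`, for positive self-adjoint
operators `A_ε`. A pair `(φ, f)` belongs to it if `(I + A_ε)⁻¹ (φ + f) → φ`; thus
`(I + A₀)⁻¹ g = lim (I + A_ε)⁻¹ g`. Here `φ_ε = (I + A_ε)⁻¹ g` is written as
`(φ_ε, g - φ_ε) ∈ graph A_ε`. -/
def resolventLimitGraph (A : ℝ → 𝓗 →ₗ.[ℂ] 𝓗) : Submodule ℂ (𝓗 × 𝓗) where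
  carrier := {p | ∃ u : ℝ → 𝓗, (∀ ε > 0, (u ε, (p.1 + p.2) - u ε) ∈ (A ε).graph) ∧
    Tendsto u (𝓝[>] 0) (𝓝 p.1)}
  zero_mem' := ⟨0, fun ε _ => by
    simp, tendsto_const_nhds⟩
  add_mem' := by
    rintro ⟨x, f⟩ ⟨y, g⟩ ⟨u, hu, hu'⟩ ⟨v, hv, hv'⟩
    refine ⟨u + v, fun ε hε => ?_, hu'.add hv'⟩
    convert (A ε).graph.add_mem (hu ε hε) (hv ε hε) using 1
    simp only [Prod.mk_add_mk, Pi.add_apply, Prod.mk.injEq, true_and]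
    abel
  smul_mem' := by
    rintro c ⟨x, f⟩ ⟨u, hu, hu'⟩
    refine ⟨c • u, fun ε hε => ?_, hu'.const_smul c⟩
    convert (A ε).graph.smul_mem c (hu ε hε) using 1
    simp [smul_sub, smul_add]

/-- The strong resolvent limit of positive self-adjoint operators `A_ε` as `ε ↓ 0`. -/
def resolventLimit (A : ℝ → 𝓗 →ₗ.[ℂ] 𝓗) : 𝓗 →ₗ.[ℂ] 𝓗 := (resolventLimitGraph A).toLinearPMap

end Abstract

/-! ### The forms on `L²(ℝᵈ)` -/

/-- The Hilbert space `L²(ℝᵈ)` of complex-valued functions. -/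
abbrev L2 (d : ℕ) : Type := Lp ℂ 2 (volume : Measure (EuclideanSpace ℝ (Fin d)))

/-- The partial derivative `∂ᵢ` as an operator on `L²(ℝᵈ)`: `φ ∈ D(∂ᵢ)` and `∂ᵢ φ = ψ` if
`φ, ψ ∈ L²(ℝᵈ)` and `∂ᵢ φ = ψ` in the sense of (tempered) distributions. -/
def partialDeriv {d : ℕ} (i : Fin d) : L2 d →ₗ.[ℂ] L2 d :=
  Submodule.toLinearPMap
    { carrier := {p | ∂_{EuclideanSpace.single i (1 : ℝ)}
        (p.1 : 𝓢'(EuclideanSpace ℝ (Fin d), ℂ)) = (p.2 : 𝓢'(EuclideanSpace ℝ (Fin d), ℂ))}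
      zero_mem' := by
        change ∂_{_} (Lp.toTemperedDistributionCLM ℂ volume 2 (0 : L2 d)) =
          Lp.toTemperedDistributionCLM ℂ volume 2 (0 : L2 d)
        rw [map_zero, LineDeriv.lineDerivOp_zero]
      add_mem' := by
        intro p q hp hq
        change ∂_{_} (Lp.toTemperedDistributionCLM ℂ volume 2 (p.1 + q.1)) =
          Lp.toTemperedDistributionCLM ℂ volume 2 (p.2 + q.2)
        rw [map_add, map_add, LineDeriv.lineDerivOp_add]
        exact congrArg₂ (· + ·) hp hq
      smul_mem' := by
        intro c p hp
        change ∂_{_} (Lp.toTemperedDistributionCLM ℂ volume 2 (c • p.1)) =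
          Lp.toTemperedDistributionCLM ℂ volume 2 (c • p.2)
        rw [map_smul, map_smul, LineDeriv.lineDerivOp_smul]
        exact congrArg (c • ·) hp }

/-- The Sobolev space `W^{1,2}(ℝᵈ) = ⋂ᵢ D(∂ᵢ)`. -/
def W12 (d : ℕ) : Submodule ℂ (L2 d) := ⨅ i : Fin d, (partialDeriv i).domain

/-- The partial derivative `∂ᵢ` on `W^{1,2}(ℝᵈ)`. -/
def grad {d : ℕ} (i : Fin d) : W12 d →ₗ[ℂ] L2 d :=
  (partialDeriv i).toFun ∘ₗ
    Submodule.inclusion (iInf_le (fun i : Fin d => (partialDeriv i).domain) i)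

/-- Coefficient matrices `C = (c_{ij})` with real, essentially bounded measurable entries, symmetric
and positive-semidefinite almost everywhere. -/
structure Coefficients (d : ℕ) where
  /-- the matrix `C(x)` -/
  mat : EuclideanSpace ℝ (Fin d) → Matrix (Fin d) (Fin d) ℝ
  bounded : ∀ i j, MemLp (fun x => mat x i j) ∞ volume
  posSemidef : ∀ᵐ x, (mat x).PosSemidef

variable {d : ℕ}

theorem integrable_term (C : Coefficients d) (i j : Fin d) (f g : L2 d) :
    Integrable (fun x => conj (f x) * (C.mat x i j : ℂ) * g x) volume := by
  have hg : MemLp (fun x => (C.mat x i j : ℂ) * g x) 2 volume :=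
    (Lp.memLp g).mul (C.bounded i j).ofReal
  have hf : MemLp (fun x => conj (f x)) 2 volume := (Lp.memLp f).star
  refine (hf.integrable_mul hg).congr (Eventually.of_forall fun x => ?_)
  simp [mul_assoc]

/-- The form
`h(φ, ψ) = ∑_{i,j} ∫ conj(∂ᵢφ) c_{ij} ∂ⱼψ` with domain `W^{1,2}(ℝᵈ)`. -/
def ellipticForm (C : Coefficients d) : Form (L2 d) where
  domain := W12 d
  sesq := LinearMap.mk₂'ₛₗ (starRingEnd ℂ) (RingHom.id ℂ)
    (fun φ ψ => ∑ i, ∑ j, ∫ x, conj (grad i φ x) * (C.mat x i j : ℂ) * grad j ψ x)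
    (by
      intro φ₁ φ₂ ψ
      simp only [← Finset.sum_add_distrib]
      refine Finset.sum_congr rfl fun i _ => Finset.sum_congr rfl fun j _ => ?_
      rw [← integral_add (integrable_term C i j _ _) (integrable_term C i j _ _)]
      refine integral_congr_ae ?_
      rw [map_add]
      filter_upwards [Lp.coeFn_add (grad i φ₁) (grad i φ₂)] with x hx
      simp only [hx, Pi.add_apply, map_add]
      ring)
    (by
      intro c φ ψ
      simp only [smul_eq_mul, Finset.mul_sum]
      refine Finset.sum_congr rfl fun i _ => Finset.sum_congr rfl fun j _ => ?_
      rw [← integral_const_mul]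
      refine integral_congr_ae ?_
      rw [map_smul]
      filter_upwards [Lp.coeFn_smul c (grad i φ)] with x hx
      simp only [hx, Pi.smul_apply, smul_eq_mul, map_mul]
      ring)
    (by
      intro φ ψ₁ ψ₂
      simp only [← Finset.sum_add_distrib]
      refine Finset.sum_congr rfl fun i _ => Finset.sum_congr rfl fun j _ => ?_
      rw [← integral_add (integrable_term C i j _ _) (integrable_term C i j _ _)]
      refine integral_congr_ae ?_
      rw [map_add]
      filter_upwards [Lp.coeFn_add (grad j ψ₁) (grad j ψ₂)] with x hx
      simp only [hx, Pi.add_apply]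
      ring)
    (by
      intro c φ ψ
      simp only [smul_eq_mul, Finset.mul_sum, RingHom.id_apply]
      refine Finset.sum_congr rfl fun i _ => Finset.sum_congr rfl fun j _ => ?_
      rw [← integral_const_mul]
      refine integral_congr_ae ?_
      rw [map_smul]
      filter_upwards [Lp.coeFn_smul c (grad j ψ)] with x hx
      simp only [hx, Pi.smul_apply, smul_eq_mul]
      ring)

/-- The form `l(φ) = ∑ᵢ ‖∂ᵢφ‖₂²` with domain `W^{1,2}(ℝᵈ)`. -/
def laplaceForm (d : ℕ) : Form (L2 d) where
  domain := W12 d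
  sesq := ∑ i : Fin d, pullback (innerₛₗ ℂ) (grad i)

/-- The self-adjoint (positive) Laplacian `Δ = -∑ᵢ ∂ᵢ²` on `L²(ℝᵈ)`. -/
def laplacian (d : ℕ) : L2 d →ₗ.[ℂ] L2 d := (laplaceForm d).operator

/-- The viscosity operator `H₀`: the strong resolvent limit, as `ε ↓ 0`, of the operators `H_ε`
associated with the forms `h_ε = h + ε l`. -/
def viscosityOperator (C : Coefficients d) : L2 d →ₗ.[ℂ] L2 d :=
  resolventLimit fun ε => (ellipticForm C + ε • laplaceForm d).operator

/-- The form `h₀` associated with the viscosity operator `H₀`. -/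
def viscosityForm (C : Coefficients d) : Form (L2 d) := formOf (viscosityOperator C)

end Viscosity

end

/-! The argument separates an operator-theoretic fact about $h_0$ from an analytic fact about $C$.

Operator side: for a closed positive form $a$ let $J_a$ be the inclusion into the ambient space of
$D(a)$, made a Hilbert space by $a(\cdot,\cdot)+(\cdot,\cdot)$. Then $(I+A)^{-1}=J_aJ_a^*$, and by
Douglas' lemma $b\le a$ holds exactly when $J_aJ_a^*\le J_bJ_b^*$
(`Form.le_iff_re_inner_resolvent_le`). As $\varepsilon\downarrow0$ the resolvents of $h_\varepsilon$
increase and are bounded, so they converge strongly. The form of the limit is the largest closed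
form below every $h_\varepsilon$ (`isGreatest_formOf_resolventLimit`). Hence $h_0\le h$ always, and
$h=h_0$ as soon as $h$ is closed; conversely $h_0$ is closed. This gives 1 ⇔ 2, it gives 7 ⇒ 5
through $h_0\le h$, and it gives 4 ⇒ 6 because condition 4 makes $h$ closed.

Analytic side: bounded coefficients give $h\le Ml$. If $h$ is closed, $h+\|\cdot\|^2$ and
$l+\|\cdot\|^2$ are two complete norms on $W^{1,2}$, one dominating the other, so the open mapping
theorem makes them equivalent; this is condition 5 (`Form.exists_value_le`). To pass from 5 to 3,
test with $\chi e^{ik\xi\cdot x}$: the $k^2$ term is $\int\chi^2\,\xi\cdot(C-\mu I)\xi$, while the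
$\nu$ term does not depend on $k$. Letting $k$ grow, then varying $\chi$ and $\xi$, gives $C\ge\mu
I$ almost everywhere with the same $\mu$ (`ae_posSemidef_of_le`). Integrating returns 4, and
comparability with the closed form $l$ returns 1. -/

noncomputable section

namespace Viscosity

/-! ### Closed positive forms and their resolvents -/

section AbstractForms

variable {𝓗 : Type*} [NormedAddCommGroup 𝓗] [InnerProductSpace ℂ 𝓗]

open scoped InnerProductSpace InnerProduct

/-- Douglas' factorization lemma: a majorization of adjoints yields a range inclusion with control
of the norms of preimages. -/
theorem exists_preimage_of_norm_adjoint_le {V W : Type*}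
    [NormedAddCommGroup V] [InnerProductSpace ℂ V] [CompleteSpace V]
    [NormedAddCommGroup W] [InnerProductSpace ℂ W] [CompleteSpace W] [CompleteSpace 𝓗]
    (J : V →L[ℂ] 𝓗) (K : W →L[ℂ] 𝓗)
    (hJK : ∀ g, ‖J.adjoint g‖ ≤ ‖K.adjoint g‖) (v : V) :
    ∃ w, K w = J v ∧ ‖w‖ ≤ ‖v‖ := by
  let T : 𝓗 →ₗ[ℂ] W := K.adjoint.toLinearMap
  obtain ⟨s, hs⟩ := T.rangeRestrict.exists_rightInverse_of_surjective T.range_rangeRestrict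
  -- The functional $K^*g\mapsto\langle v,J^*g\rangle$ on the range of $K^*$ is well defined because
  -- $\ker K^*\subseteq\ker J^*$; the section `s` picks a preimage. Hahn–Banach and Riesz then
  -- represent it by the required `w`.
  let f₀ : 𝓗 →ₗ[ℂ] ℂ := (innerₛₗ ℂ v) ∘ₗ J.adjoint.toLinearMap
  have key : ∀ g, f₀ (s (T.rangeRestrict g)) = f₀ g := by
    intro g
    have h1 : T (s (T.rangeRestrict g) - g) = 0 := by
      rw [map_sub, sub_eq_zero]
      exact congrArg Subtype.val (LinearMap.congr_fun hs (T.rangeRestrict g))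
    have h2 : J.adjoint (s (T.rangeRestrict g) - g) = 0 := by
      have := hJK (s (T.rangeRestrict g) - g)
      rw [show K.adjoint (s (T.rangeRestrict g) - g) = 0 from h1, norm_zero] at this
      exact norm_le_zero_iff.1 this
    rw [← sub_eq_zero, ← map_sub]
    simp [f₀, h2]
  have bound : ∀ y : LinearMap.range T, ‖(f₀ ∘ₗ s) y‖ ≤ ‖v‖ * ‖y‖ := by
    rintro ⟨_, g, rfl⟩
    have : (f₀ ∘ₗ s) ⟨T g, ⟨g, rfl⟩⟩ = f₀ g := key g
    rw [this]
    calc ‖f₀ g‖ = ‖inner ℂ v (J.adjoint g)‖ := rfl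
      _ ≤ ‖v‖ * ‖J.adjoint g‖ := norm_inner_le_norm _ _
      _ ≤ ‖v‖ * ‖K.adjoint g‖ := by gcongr; exact hJK g
  let f : StrongDual ℂ (LinearMap.range T) := (f₀ ∘ₗ s).mkContinuous ‖v‖ bound
  obtain ⟨F, hF, hFn⟩ := exists_extension_norm_eq (LinearMap.range T) f
  let w := (InnerProductSpace.toDual ℂ W).symm F
  refine ⟨w, ?_, ?_⟩
  · refine ext_inner_right ℂ fun g => ?_
    rw [← ContinuousLinearMap.adjoint_inner_right, ← ContinuousLinearMap.adjoint_inner_right,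
      InnerProductSpace.toDual_symm_apply]
    exact (hF ⟨T g, ⟨g, rfl⟩⟩).trans (key g)
  · rw [LinearIsometryEquiv.norm_map, hFn]
    exact LinearMap.mkContinuous_norm_le _ (norm_nonneg _) _

namespace Form

/-- A closed positive symmetric form. -/
structure IsClosedPos (a : Form 𝓗) : Prop where
  symm : ∀ φ ψ, conj (a.sesq φ ψ) = a.sesq ψ φ
  nonneg : ∀ φ, 0 ≤ a.value φ
  closed : a.IsClosed

/-- Two forms with the same domain and the same sesquilinear form are equal. -/
theorem ext_of_forall {a b : Form 𝓗} (hd : a.domain = b.domain)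
    (h : ∀ (φ ψ : 𝓗) (hφ : φ ∈ a.domain) (hψ : ψ ∈ a.domain),
      a.sesq ⟨φ, hφ⟩ ⟨ψ, hψ⟩ = b.sesq ⟨φ, hd ▸ hφ⟩ ⟨ψ, hd ▸ hψ⟩) : a = b := by
  obtain ⟨D, s⟩ := a
  obtain ⟨D', s'⟩ := b
  obtain rfl : D = D' := hd
  congr 1
  ext φ ψ
  exact h φ ψ φ.2 ψ.2

theorem value_add {a : Form 𝓗} (hs : ∀ φ ψ, conj (a.sesq φ ψ) = a.sesq ψ φ) (φ ψ : a.domain) :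
    a.value (φ + ψ) = a.value φ + a.value ψ + 2 * (a.sesq φ ψ).re := by
  have : (a.sesq ψ φ).re = (a.sesq φ ψ).re := by rw [← hs φ ψ, Complex.conj_re]
  simp only [value, map_add, LinearMap.add_apply, Complex.add_re, this]
  ring

/-- The order of forms is antisymmetric on symmetric forms. -/
theorem le_antisymm_of_symm {a b : Form 𝓗} (ha : ∀ φ ψ, conj (a.sesq φ ψ) = a.sesq ψ φ)
    (hb : ∀ φ ψ, conj (b.sesq φ ψ) = b.sesq ψ φ) (hab : a ≤ b) (hba : b ≤ a) : a = b := by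
  obtain ⟨h1, h1'⟩ := hab
  obtain ⟨h2, h2'⟩ := hba
  have hd : a.domain = b.domain := le_antisymm h2 h1
  have hv : ∀ φ (hφ : φ ∈ a.domain), a.value ⟨φ, hφ⟩ = b.value ⟨φ, h2 hφ⟩ := fun φ hφ =>
    le_antisymm (h1' ⟨φ, h2 hφ⟩) (h2' ⟨φ, hφ⟩)
  have hre : ∀ (φ ψ : 𝓗) (hφ : φ ∈ a.domain) (hψ : ψ ∈ a.domain),
      (a.sesq ⟨φ, hφ⟩ ⟨ψ, hψ⟩).re = (b.sesq ⟨φ, h2 hφ⟩ ⟨ψ, h2 hψ⟩).re := by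
    intro φ ψ hφ hψ
    have e1 := value_add ha ⟨φ, hφ⟩ ⟨ψ, hψ⟩
    have e2 := value_add hb ⟨φ, h2 hφ⟩ ⟨ψ, h2 hψ⟩
    have e3 := hv (φ + ψ) (a.domain.add_mem hφ hψ)
    have e4 := hv φ hφ
    have e5 := hv ψ hψ
    simp only [AddMemClass.mk_add_mk] at e1 e2
    linarith
  refine ext_of_forall hd fun φ ψ hφ hψ => Complex.ext (hre φ ψ hφ hψ) ?_
  -- The imaginary part at ψ is, up to sign, the real part at iψ.
  have := hre φ (Complex.I • ψ) hφ (a.domain.smul_mem _ hψ)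
  have e1 : a.sesq ⟨φ, hφ⟩ ⟨Complex.I • ψ, a.domain.smul_mem _ hψ⟩
      = Complex.I * a.sesq ⟨φ, hφ⟩ ⟨ψ, hψ⟩ := map_smul (a.sesq ⟨φ, hφ⟩) Complex.I ⟨ψ, hψ⟩
  have e2 : b.sesq ⟨φ, h2 hφ⟩ ⟨Complex.I • ψ, h2 (a.domain.smul_mem _ hψ)⟩
      = Complex.I * b.sesq ⟨φ, h2 hφ⟩ ⟨ψ, h2 hψ⟩ :=
    map_smul (b.sesq ⟨φ, h2 hφ⟩) Complex.I ⟨ψ, h2 hψ⟩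
  rw [e1, e2, Complex.I_mul_re, Complex.I_mul_re, neg_inj] at this
  exact this

/-- The inner product `a(φ, ψ) + (φ, ψ)` on the domain of a closed positive form. -/
@[reducible]
def innerCore {a : Form 𝓗} (ha : a.IsClosedPos) : InnerProductSpace.Core ℂ a.domain where
  inner φ ψ := a.sesq φ ψ + inner ℂ (φ : 𝓗) (ψ : 𝓗)
  conj_inner_symm φ ψ := by
    rw [map_add, ha.symm, inner_conj_symm]
  re_inner_nonneg φ := by
    rw [map_add]
    exact add_nonneg (ha.nonneg φ) inner_self_nonneg
  add_left φ ψ χ := by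
    rw [map_add, Submodule.coe_add, inner_add_left, LinearMap.add_apply]
    abel
  smul_left φ ψ c := by
    rw [map_smulₛₗ, Submodule.coe_smul, inner_smul_left, LinearMap.smul_apply, smul_eq_mul,
      ← mul_add]
  definite φ h := by
    have h' := congrArg RCLike.re h
    rw [map_add, inner_self_eq_norm_sq, map_zero] at h'
    have h1 : 0 ≤ RCLike.re (a.sesq φ φ) := ha.nonneg φ
    have h4 : ‖(φ : 𝓗)‖ ^ 2 = 0 := by nlinarith [sq_nonneg ‖(φ : 𝓗)‖]
    exact Subtype.ext (by simpa using h4)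

/-- The domain of a closed positive form, as a Hilbert space with the inner product
`a(φ, ψ) + (φ, ψ)`. -/
@[nolint unusedArguments]
def Space (a : Form 𝓗) (_ : a.IsClosedPos) : Type _ := a.domain

variable {a b : Form 𝓗} {ha : a.IsClosedPos} {hb : b.IsClosedPos}

instance : NormedAddCommGroup (a.Space ha) :=
  @InnerProductSpace.Core.toNormedAddCommGroup ℂ a.domain _ _ _ (innerCore ha)

instance : InnerProductSpace ℂ (a.Space ha) :=
  @InnerProductSpace.ofCore ℂ a.domain _ _ _ (innerCore ha).toCore

instance : Inner ℂ (a.Space ha) := InnerProductSpace.toInner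

/-- The identification of the domain of a form with the associated Hilbert space. -/
def toSpace (ha : a.IsClosedPos) : a.domain ≃ₗ[ℂ] a.Space ha := LinearEquiv.refl ℂ _

theorem inner_toSpace (φ ψ : a.domain) :
    inner ℂ (toSpace ha φ) (toSpace ha ψ) = a.sesq φ ψ + inner ℂ (φ : 𝓗) (ψ : 𝓗) := rfl

theorem norm_sq_toSpace (φ : a.domain) :
    ‖toSpace ha φ‖ ^ 2 = a.value φ + ‖(φ : 𝓗)‖ ^ 2 := by
  rw [← inner_self_eq_norm_sq (𝕜 := ℂ), inner_toSpace, map_add, inner_self_eq_norm_sq]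
  rfl

/-- The inclusion of the domain of a closed positive form in the ambient space. -/
def embed (ha : a.IsClosedPos) : a.Space ha →L[ℂ] 𝓗 :=
  LinearMap.mkContinuous (a.domain.subtype ∘ₗ (toSpace ha).symm.toLinearMap) 1 (fun φ => by
    obtain ⟨φ, rfl⟩ := (toSpace ha).surjective φ
    rw [one_mul]
    refine le_of_sq_le_sq ?_ (norm_nonneg _)
    have := norm_sq_toSpace (ha := ha) φ
    have := ha.nonneg φ
    simp only [LinearMap.comp_apply, LinearEquiv.coe_coe, LinearEquiv.symm_apply_apply,
      Submodule.subtype_apply]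
    linarith)

@[simp]
theorem embed_toSpace (φ : a.domain) : embed ha (toSpace ha φ) = φ := rfl

theorem norm_embed_le (ha : a.IsClosedPos) : ‖embed ha‖ ≤ 1 :=
  LinearMap.mkContinuous_norm_le _ zero_le_one _

variable [CompleteSpace 𝓗]

instance : CompleteSpace (a.Space ha) := by
  refine Metric.complete_of_cauchySeq_tendsto fun u hu => ?_
  obtain ⟨u, rfl⟩ : ∃ v : ℕ → a.domain, u = fun n => toSpace ha (v n) :=
    ⟨fun n => (toSpace ha).symm (u n), by simp⟩
  obtain ⟨φ, hφ⟩ := cauchySeq_tendsto_of_complete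
    ((embed ha).uniformContinuous.comp_cauchySeq hu)
  have hφ' : Tendsto (fun n => (u n : 𝓗)) atTop (𝓝 φ) := hφ
  have h0 : Tendsto (fun p : ℕ × ℕ => ‖toSpace ha (u p.1) - toSpace ha (u p.2)‖ ^ 2)
      atTop (𝓝 0) := by
    have h1 := cauchySeq_iff_tendsto_dist_atTop_0.1 hu
    simpa [dist_eq_norm] using h1.pow 2
  obtain ⟨hd, hlim⟩ := ha.closed u φ hφ' (squeeze_zero (fun p => ha.nonneg _) (fun p => by
    rw [← map_sub, norm_sq_toSpace]
    exact le_add_of_nonneg_right (sq_nonneg _)) h0)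
  refine ⟨toSpace ha ⟨φ, hd⟩, ?_⟩
  rw [tendsto_iff_norm_sub_tendsto_zero]
  have h2 : Tendsto (fun n => ‖(u n : 𝓗) - φ‖) atTop (𝓝 0) :=
    tendsto_iff_norm_sub_tendsto_zero.1 hφ'
  have h3 : Tendsto (fun n => ‖toSpace ha (u n) - toSpace ha ⟨φ, hd⟩‖ ^ 2) atTop (𝓝 0) := by
    simp_rw [← map_sub, norm_sq_toSpace]
    simpa using hlim.add (h2.pow 2)
  simpa using h3.sqrt

/-- The resolvent `(I + A)⁻¹` of the operator `A` associated with a closed positive form. -/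
def resolvent (ha : a.IsClosedPos) : 𝓗 →L[ℂ] 𝓗 := embed ha ∘L (embed ha).adjoint

theorem resolvent_apply (g : 𝓗) : resolvent ha g = embed ha ((embed ha).adjoint g) := rfl

theorem inner_resolvent_left (f g : 𝓗) :
    inner ℂ (resolvent ha f) g = inner ℂ ((embed ha).adjoint f) ((embed ha).adjoint g) := by
  rw [resolvent_apply, ContinuousLinearMap.adjoint_inner_right]

theorem inner_resolvent_self (g : 𝓗) :
    inner ℂ (resolvent ha g) g = ((‖(embed ha).adjoint g‖ ^ 2 : ℝ) : ℂ) := by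
  rw [inner_resolvent_left, inner_self_eq_norm_sq_to_K]
  norm_cast

theorem isPositive_resolvent (ha : a.IsClosedPos) : (resolvent ha).IsPositive :=
  ContinuousLinearMap.isPositive_self_comp_adjoint _

theorem norm_resolvent_le (ha : a.IsClosedPos) : ‖resolvent ha‖ ≤ 1 := by
  refine (ContinuousLinearMap.opNorm_comp_le _ _).trans ?_
  rw [LinearIsometryEquiv.norm_map]
  exact mul_le_one₀ (norm_embed_le ha) (norm_nonneg _) (norm_embed_le ha)

/-- Adding (ψ, φ) to both sides of a(ψ, φ) = (ψ, f) turns it into ⟨ψ, φ⟩ = (ψ, φ + f) in the form's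
Hilbert space, which says that φ is the adjoint embedding applied to φ + f. -/
theorem mem_operatorGraph_iff {φ f : 𝓗} :
    (φ, f) ∈ a.operatorGraph ↔ resolvent ha (φ + f) = φ := by
  constructor
  · rintro ⟨hφ, h⟩
    have : (embed ha).adjoint (φ + f) = toSpace ha ⟨φ, hφ⟩ := by
      refine ext_inner_left ℂ fun ψ => ?_
      obtain ⟨ψ, rfl⟩ := (toSpace ha).surjective ψ
      rw [ContinuousLinearMap.adjoint_inner_right, inner_toSpace, embed_toSpace, inner_add_right,
        add_comm]
      exact congrArg (· + _) (h ψ).symm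
    rw [resolvent_apply, this, embed_toSpace]
  · intro h
    obtain ⟨v, hv⟩ := (toSpace ha).surjective ((embed ha).adjoint (φ + f))
    have h1 : (v : 𝓗) = φ := by rw [← h, resolvent_apply, ← hv, embed_toSpace]
    subst h1
    refine ⟨v.2, fun ψ => ?_⟩
    have := ContinuousLinearMap.adjoint_inner_right (embed ha) (toSpace ha ψ) (v + f)
    rw [← hv, inner_toSpace, embed_toSpace, inner_add_right, add_comm] at this
    exact add_left_cancel this

/-- With $v=J_a^*g\in D(a)\subseteq D(b)$ one has $\|v\|_a^2=(v,g)=\langle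
v,J_b^*g\rangle_b\le\|v\|_b\|J_b^*g\|_b\le\|v\|_a\|J_b^*g\|_b$; then cancel $\|v\|_a$. -/
theorem norm_adjoint_le_of_le (hab : b ≤ a) (g : 𝓗) :
    ‖(embed ha).adjoint g‖ ≤ ‖(embed hb).adjoint g‖ := by
  obtain ⟨hd, hv⟩ := hab
  obtain ⟨v, hv'⟩ := (toSpace ha).surjective ((embed ha).adjoint g)
  rw [← hv']
  set w : b.domain := ⟨v, hd v.2⟩
  have h1 : ‖toSpace hb w‖ ≤ ‖toSpace ha v‖ := by
    refine le_of_sq_le_sq ?_ (norm_nonneg _)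
    rw [norm_sq_toSpace, norm_sq_toSpace]
    exact add_le_add_left (hv v) _
  have h2 : inner ℂ (toSpace ha v) (toSpace ha v)
      = inner ℂ (toSpace hb w) ((embed hb).adjoint g) := by
    rw [ContinuousLinearMap.adjoint_inner_right]
    conv_lhs => rw [hv']
    rw [ContinuousLinearMap.adjoint_inner_right, ← hv']
    rfl
  have h3 : ‖toSpace ha v‖ * ‖toSpace ha v‖ ≤ ‖toSpace ha v‖ * ‖(embed hb).adjoint g‖ := by
    rw [← sq, ← inner_self_eq_norm_sq (𝕜 := ℂ), h2]
    exact (re_inner_le_norm _ _).trans (by gcongr)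
  rcases (norm_nonneg (toSpace ha v)).eq_or_lt with h | h
  · rw [← h]; exact norm_nonneg _
  · exact le_of_mul_le_mul_left h3 h

/-- Douglas' lemma lifts φ through the embedding of D(b) without increasing the norm. Since that
embedding is the inclusion, the lift is φ itself, and the ambient norms cancel. -/
theorem le_of_norm_adjoint_le
    (h : ∀ g, ‖(embed ha).adjoint g‖ ≤ ‖(embed hb).adjoint g‖) : b ≤ a := by
  have key : ∀ φ : a.domain, ∃ ψ : b.domain, (ψ : 𝓗) = φ ∧ b.value ψ ≤ a.value φ := by
    intro φ
    obtain ⟨w, hw, hn⟩ := exists_preimage_of_norm_adjoint_le (embed ha) (embed hb) h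
      (toSpace ha φ)
    obtain ⟨w, rfl⟩ := (toSpace hb).surjective w
    refine ⟨w, hw, ?_⟩
    have h2 := pow_le_pow_left₀ (norm_nonneg _) hn 2
    rw [norm_sq_toSpace, norm_sq_toSpace, show (w : 𝓗) = φ from hw] at h2
    linarith
  have hd : a.domain ≤ b.domain := fun φ hφ => by
    obtain ⟨ψ, hψ, -⟩ := key ⟨φ, hφ⟩
    exact (show (ψ : 𝓗) = φ from hψ) ▸ ψ.2
  refine ⟨hd, fun φ => ?_⟩
  obtain ⟨ψ, hψ, hle⟩ := key φ
  rwa [show (⟨φ, hd φ.2⟩ : b.domain) = ψ from Subtype.ext hψ.symm]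

/-- A closed positive form is determined by its resolvent. -/
theorem eq_of_resolvent_eq (h : resolvent ha = resolvent hb) : a = b := by
  have key : ∀ g, ‖(embed ha).adjoint g‖ = ‖(embed hb).adjoint g‖ := by
    intro g
    have h1 := inner_resolvent_self (ha := ha) g
    rw [h, inner_resolvent_self] at h1
    have h2 : ‖(embed hb).adjoint g‖ ^ 2 = ‖(embed ha).adjoint g‖ ^ 2 := by exact_mod_cast h1
    exact ((sq_eq_sq₀ (norm_nonneg _) (norm_nonneg _)).1 h2).symm
  exact le_antisymm_of_symm ha.symm hb.symm
    (le_of_norm_adjoint_le (ha := hb) (hb := ha) fun g => (key g).ge)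
    (le_of_norm_adjoint_le (ha := ha) (hb := hb) fun g => (key g).le)

/-- $(Rg,g)=\|J^*g\|^2$, so $Rg=0$ makes $g$ orthogonal to the dense domain. -/
theorem injective_resolvent (ha : a.IsClosedPos) (hd : Dense (a.domain : Set 𝓗)) :
    Function.Injective (resolvent ha) := by
  rw [injective_iff_map_eq_zero]
  intro g hg
  have h1 : (embed ha).adjoint g = 0 := by
    have := inner_resolvent_self (ha := ha) g
    rw [hg, inner_zero_left] at this
    have h2 : ‖(embed ha).adjoint g‖ ^ 2 = 0 := by exact_mod_cast this.symm
    simpa using h2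
  refine hd.eq_zero_of_inner_left ℂ fun v hv => ?_
  have := ContinuousLinearMap.adjoint_inner_right (embed ha) (toSpace ha ⟨v, hv⟩) g
  rw [h1, inner_zero_right, embed_toSpace] at this
  rw [← inner_conj_symm, ← this, map_zero]

/-- Density makes the relation single-valued, so that passing to a partial operator keeps the graph.
-/
theorem mem_graph_operator_iff (ha : a.IsClosedPos) (hd : Dense (a.domain : Set 𝓗)) {φ f : 𝓗} :
    (φ, f) ∈ a.operator.graph ↔ resolvent ha (φ + f) = φ := by
  rw [operator, Submodule.toLinearPMap_graph_eq, mem_operatorGraph_iff (ha := ha)]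
  rintro ⟨x, f⟩ hx (rfl : x = 0)
  rw [mem_operatorGraph_iff (ha := ha), zero_add] at hx
  exact injective_resolvent ha hd (hx.trans (map_zero _).symm)

end Form

end AbstractForms

/-! ### Square roots and the representation theorem -/

section SquareRoot

variable {𝓗 : Type*} [NormedAddCommGroup 𝓗] [InnerProductSpace ℂ 𝓗]

/-- A form `φ ↦ ‖T φ‖²` is closed if the operator `T` is closed. -/
theorem Form.isClosed_of_value_eq {K : Type*} [NormedAddCommGroup K] [NormedSpace ℂ K]
    [CompleteSpace K] {a : Form 𝓗} (T : a.domain →ₗ[ℂ] K) (hT : ∀ φ, a.value φ = ‖T φ‖ ^ 2)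
    (hcl : ∀ (u : ℕ → a.domain) (φ : 𝓗) (y : K), Tendsto (fun n => (u n : 𝓗)) atTop (𝓝 φ) →
      Tendsto (fun n => T (u n)) atTop (𝓝 y) → ∃ hφ : φ ∈ a.domain, T ⟨φ, hφ⟩ = y) :
    a.IsClosed := by
  intro u φ hu hc
  have h1 : CauchySeq fun n => T (u n) := by
    rw [cauchySeq_iff_tendsto_dist_atTop_0]
    simp_rw [hT, map_sub] at hc
    simpa [dist_eq_norm] using hc.sqrt
  obtain ⟨y, hy⟩ := cauchySeq_tendsto_of_complete h1
  obtain ⟨hφ, hφy⟩ := hcl u φ y hu hy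
  refine ⟨hφ, ?_⟩
  simp_rw [hT, map_sub, hφy]
  simpa using (tendsto_iff_norm_sub_tendsto_zero.1 hy).pow 2

theorem dense_range_of_injective_isSelfAdjoint [CompleteSpace 𝓗] {B : 𝓗 →L[ℂ] 𝓗}
    (hB : IsSelfAdjoint B) (hi : Function.Injective B) :
    Dense (LinearMap.range B.toLinearMap : Set 𝓗) := by
  rw [Submodule.dense_iff_topologicalClosure_eq_top, Submodule.topologicalClosure_eq_top_iff,
    Submodule.eq_bot_iff]
  intro x hx
  refine (injective_iff_map_eq_zero B).1 hi x (ext_inner_left ℂ fun y => ?_)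
  rw [inner_zero_right, ← ContinuousLinearMap.adjoint_inner_left,
    ← ContinuousLinearMap.star_eq_adjoint, hB.star_eq]
  exact (Submodule.mem_orthogonal _ _).1 hx _ ⟨y, rfl⟩

theorem inner_apply_comm [CompleteSpace 𝓗] {B : 𝓗 →L[ℂ] 𝓗} (hB : IsSelfAdjoint B) (x y : 𝓗) :
    inner ℂ (B x) y = inner ℂ x (B y) := by
  rw [← ContinuousLinearMap.adjoint_inner_left, ← ContinuousLinearMap.star_eq_adjoint, hB.star_eq]

/-- For `0 ≤ R ≤ 1` there are commuting self-adjoint `B`, `T` with `B² = R`, `T² = 1 - R` and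
`B T ≥ 0`. -/
theorem exists_sqrt_pair [CompleteSpace 𝓗] {R : 𝓗 →L[ℂ] 𝓗} (hR : R.IsPositive)
    (hR1 : ‖R‖ ≤ 1) : ∃ B T : 𝓗 →L[ℂ] 𝓗, IsSelfAdjoint B ∧ IsSelfAdjoint T ∧
      (∀ x, B (B x) = R x) ∧ (∀ x, T (T x) = x - R x) ∧ (∀ x, B (T x) = T (B x)) ∧
      ∀ x, 0 ≤ (inner ℂ (B x) (T x)).re := by
  have hsa : IsSelfAdjoint R := hR.isSelfAdjoint
  have h0 : ∀ x ∈ spectrum ℝ R, 0 ≤ x := fun x hx =>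
    spectrum_nonneg_of_nonneg ((ContinuousLinearMap.nonneg_iff_isPositive R).2 hR) hx
  have h1 : ∀ x ∈ spectrum ℝ R, x ≤ 1 := fun x hx => by
    refine (le_abs_self x).trans ((spectrum.norm_le_norm_mul_of_mem hx).trans ?_)
    exact mul_le_one₀ hR1 (norm_nonneg _) ContinuousLinearMap.norm_id_le
  have hB : IsSelfAdjoint (cfc Real.sqrt R) := cfc_predicate _ _
  have e1 : cfc Real.sqrt R * cfc Real.sqrt R = R := by
    rw [← cfc_mul _ _ R]
    conv_rhs => rw [← cfc_id ℝ R]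
    exact cfc_congr fun x hx => Real.mul_self_sqrt (h0 x hx)
  have e2 : cfc (fun x : ℝ => √(1 - x)) R * cfc (fun x : ℝ => √(1 - x)) R = 1 - R := by
    rw [← cfc_mul _ _ R]
    have : (1 : 𝓗 →L[ℂ] 𝓗) - R = cfc (fun x : ℝ => 1 - x) R := by
      rw [cfc_sub (fun _ => (1 : ℝ)) (fun x => x) R, cfc_const_one ℝ R, cfc_id' ℝ R]
    rw [this]
    exact cfc_congr fun x hx => Real.mul_self_sqrt (sub_nonneg.2 (h1 x hx))
  have e3 : cfc Real.sqrt R * cfc (fun x : ℝ => √(1 - x)) R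
      = cfc (fun x : ℝ => √(1 - x)) R * cfc Real.sqrt R := cfc_commute_cfc _ _ R
  have e4 : (cfc Real.sqrt R * cfc (fun x : ℝ => √(1 - x)) R).IsPositive := by
    rw [← ContinuousLinearMap.nonneg_iff_isPositive, ← cfc_mul _ _ R]
    exact cfc_nonneg fun x _ => by positivity
  refine ⟨cfc Real.sqrt R, cfc (fun x => √(1 - x)) R, hB, cfc_predicate _ _,
    fun x => DFunLike.congr_fun e1 x, fun x => DFunLike.congr_fun e2 x,
    fun x => DFunLike.congr_fun e3 x, fun x => ?_⟩
  rw [inner_apply_comm hB]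
  exact e4.re_inner_nonneg_right x

variable [CompleteSpace 𝓗]

/-- A positive self-adjoint operator, given through its resolvent, has a positive square root. -/
theorem exists_isPositiveSqrt {A : 𝓗 →ₗ.[ℂ] 𝓗} {R : 𝓗 →L[ℂ] 𝓗} (hR : R.IsPositive)
    (hR1 : ‖R‖ ≤ 1) (hi : Function.Injective R)
    (hA : ∀ φ f, (φ, f) ∈ A.graph ↔ R (φ + f) = φ) : ∃ S, IsPositiveSqrt S A := by
  obtain ⟨B, T, hB, hT, hBB, hTT, hBT, hpos⟩ := exists_sqrt_pair hR hR1
  have hBi : Function.Injective B := fun x y hxy => hi (by rw [← hBB, ← hBB, hxy])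
  have hid : ∀ x, B (B x) + T (T x) = x := fun x => by rw [hBB, hTT]; abel
  -- Formally $A=R^{-1}-1$, so $A^{1/2}=TB^{-1}$ with $B=\sqrt R$ and $T=\sqrt{1-R}$; its graph is
  -- parametrized by $x\mapsto(Bx,Tx)$.
  let G : Submodule ℂ (𝓗 × 𝓗) := LinearMap.range (B.toLinearMap.prod T.toLinearMap)
  have hG : ∀ φ ψ, (φ, ψ) ∈ G ↔ ∃ x, B x = φ ∧ T x = ψ := fun φ ψ => by
    simp [G, LinearMap.mem_range, Prod.ext_iff]
  have hgr : G.toLinearPMap.graph = G := by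
    refine Submodule.toLinearPMap_graph_eq _ ?_
    rintro ⟨φ, ψ⟩ h (rfl : φ = 0)
    obtain ⟨x, hx, rfl⟩ := (hG _ _).1 h
    rw [(injective_iff_map_eq_zero B).1 hBi x hx, map_zero]
  set S := G.toLinearPMap
  have hS : ∀ φ ψ, (φ, ψ) ∈ S.graph ↔ ∃ x, B x = φ ∧ T x = ψ := fun φ ψ => by rw [hgr, hG]
  have hdom : S.domain = LinearMap.range B.toLinearMap := by
    ext φ
    simp [LinearPMap.mem_domain_iff, hS]
  have hdense : Dense (S.domain : Set 𝓗) := by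
    rw [hdom]; exact dense_range_of_injective_isSelfAdjoint hB hBi
  refine ⟨S, ?_, ?_, ?_⟩
  · rw [LinearPMap.isSelfAdjoint_def]
    refine LinearPMap.eq_of_eq_graph ?_
    rw [LinearPMap.adjoint_graph_eq_graph_adjoint hdense]
    ext ⟨φ, ψ⟩
    rw [Submodule.mem_adjoint_iff, hS]
    constructor
    · intro h
      have h1 : T φ = B ψ := by
        refine ext_inner_left ℂ fun x => ?_
        have := h (B x) (T x) ((hS _ _).2 ⟨x, rfl, rfl⟩)
        rw [sub_eq_zero] at this
        rw [← inner_apply_comm hT, ← inner_apply_comm hB]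
        exact this
      -- Membership in the adjoint graph amounts to Tφ = Bψ; the parameter of (φ, ψ) is then
      -- recovered from B² + T² = 1.
      refine ⟨B φ + T ψ, ?_, ?_⟩
      · rw [map_add, hBT, ← h1, hid]
      · rw [map_add, ← hBT, h1, hid]
    · rintro ⟨y, rfl, rfl⟩ a b hab
      obtain ⟨x, rfl, rfl⟩ := (hS _ _).1 hab
      rw [sub_eq_zero, inner_apply_comm hT, inner_apply_comm hB, hBT]
  · intro φ
    obtain ⟨x, hx, hx'⟩ := (hS _ _).1 (S.mem_graph φ)
    rw [← hx, ← hx']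
    exact hpos x
  · intro φ f
    rw [hA]
    constructor
    · intro h
      refine ⟨T (B (φ + f)), (hS _ _).2 ⟨B (φ + f), by rw [hBB, h], rfl⟩,
        (hS _ _).2 ⟨T (φ + f), hBT _, ?_⟩⟩
      rw [hTT, h, add_sub_cancel_left]
    · rintro ⟨ψ, h1, h2⟩
      obtain ⟨x, rfl, rfl⟩ := (hS _ _).1 h1
      obtain ⟨y, hy, rfl⟩ := (hS _ _).1 h2
      have hx : x = B (B x + T y) := by rw [map_add, hBT, hy, hid]
      rw [← hBB, ← hx]

/-- The default value is the everywhere defined zero operator, which is closed too; hence no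
condition on `A` is needed. -/
theorem isClosed_opSqrt (A : 𝓗 →ₗ.[ℂ] 𝓗) : (opSqrt A).IsClosed := by
  unfold opSqrt
  split_ifs with h
  · exact h.choose_spec.1.isClosed
  · have : ((0 : 𝓗 →ₗ.[ℂ] 𝓗).graph : Set (𝓗 × 𝓗)) = {p | p.2 = 0} := by
      ext ⟨x, y⟩
      simp [LinearPMap.mem_graph_iff, eq_comm]
    rw [LinearPMap.IsClosed, this]
    exact isClosed_eq continuous_snd continuous_const

theorem isClosedPos_formOf (A : 𝓗 →ₗ.[ℂ] 𝓗) : (formOf A).IsClosedPos where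
  symm _ _ := inner_conj_symm _ _
  nonneg φ := inner_self_nonneg (𝕜 := ℂ) (x := opSqrt A φ)
  closed := by
    refine Form.isClosed_of_value_eq (opSqrt A).toFun
      (fun φ => inner_self_eq_norm_sq (𝕜 := ℂ) (opSqrt A φ)) fun u φ y hu hy => ?_
    have h1 : (φ, y) ∈ (opSqrt A).graph := by
      refine (isClosed_opSqrt A).mem_of_tendsto (hu.prodMk_nhds hy)
        (Eventually.of_forall fun n => (opSqrt A).mem_graph (u n))
    obtain ⟨z, hz, hz'⟩ := (LinearPMap.mem_graph_iff _).1 h1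
    obtain rfl : (z : 𝓗) = φ := hz
    exact ⟨z.2, hz'⟩

/-- The form of a positive self-adjoint operator has the resolvent of the operator. -/
theorem resolvent_formOf {A : 𝓗 →ₗ.[ℂ] 𝓗} {R : 𝓗 →L[ℂ] 𝓗} (hR : R.IsPositive)
    (hR1 : ‖R‖ ≤ 1) (hi : Function.Injective R)
    (hA : ∀ φ f, (φ, f) ∈ A.graph ↔ R (φ + f) = φ) :
    Form.resolvent (isClosedPos_formOf A) = R := by
  have hex := exists_isPositiveSqrt hR hR1 hi hA
  have hS : IsPositiveSqrt (opSqrt A) A := by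
    rw [opSqrt, dif_pos hex]; exact hex.choose_spec
  ext g
  have h1 : (R g, g - R g) ∈ A.graph := (hA _ _).2 (by rw [add_sub_cancel])
  obtain ⟨ψ, h2, h3⟩ := (hS.2.2 _ _).1 h1
  -- Only the defining properties of the chosen root S enter: (Sχ, Sz) = (χ, S(Sz)) by
  -- self-adjointness. Uniqueness of the root is therefore never needed.
  have h4 : (R g, g - R g) ∈ (formOf A).operatorGraph := by
    obtain ⟨z, hz, rfl⟩ := (LinearPMap.mem_graph_iff _).1 h2
    obtain ⟨w, hw, hw'⟩ := (LinearPMap.mem_graph_iff _).1 h3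
    have hz' : (z : 𝓗) = R g := hz
    have hw1 : (w : 𝓗) = opSqrt A z := hw
    have hw2 : opSqrt A w = g - R g := hw'
    refine ⟨hz' ▸ z.2, fun χ => ?_⟩
    have hz2 : (⟨R g, hz' ▸ z.2⟩ : (opSqrt A).domain) = z := Subtype.ext hz'.symm
    have h5 := LinearPMap.adjoint_isFormalAdjoint hS.1.dense_domain
    rw [LinearPMap.isSelfAdjoint_def.1 hS.1] at h5
    change inner ℂ (opSqrt A χ) (opSqrt A ⟨R g, hz' ▸ z.2⟩) = _
    rw [hz2, ← hw1, ← hw2]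
    exact h5 χ w
  have := (Form.mem_operatorGraph_iff (ha := isClosedPos_formOf A)).1 h4
  rwa [add_sub_cancel] at this

/-- The representation theorem: a densely defined closed positive form is the form of the
associated operator. -/
theorem formOf_operator {a : Form 𝓗} (ha : a.IsClosedPos) (hd : Dense (a.domain : Set 𝓗)) :
    formOf a.operator = a :=
  Form.eq_of_resolvent_eq (ha := isClosedPos_formOf _) (hb := ha) <|
    resolvent_formOf (Form.isPositive_resolvent ha) (Form.norm_resolvent_le ha)
      (Form.injective_resolvent ha hd) fun _ _ => Form.mem_graph_operator_iff ha hd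

end SquareRoot

/-! ### Monotone limits of resolvents -/

section MonotoneLimit

variable {𝓗 : Type*} [NormedAddCommGroup 𝓗] [InnerProductSpace ℂ 𝓗] [CompleteSpace 𝓗]

/-- Write $Dg=\sqrt D\sqrt D g$. The estimate upgrades convergence of the quadratic forms to strong
convergence. -/
theorem norm_apply_sq_le_of_isPositive {D : 𝓗 →L[ℂ] 𝓗} (hD : D.IsPositive) (g : 𝓗) :
    ‖D g‖ ^ 2 ≤ ‖D‖ * (inner ℂ (D g) g).re := by
  have hD0 : 0 ≤ D := (ContinuousLinearMap.nonneg_iff_isPositive D).2 hD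
  have hB : IsSelfAdjoint (CFC.sqrt D) := (CFC.sqrt_nonneg D).isSelfAdjoint
  have hBB : CFC.sqrt D * CFC.sqrt D = D := CFC.sqrt_mul_sqrt_self D hD0
  have h1 : ‖CFC.sqrt D‖ ^ 2 = ‖D‖ := by
    rw [sq, ← CStarRing.norm_star_mul_self, hB.star_eq, hBB]
  have h2 : D g = CFC.sqrt D (CFC.sqrt D g) := (DFunLike.congr_fun hBB g).symm
  have h3 : (inner ℂ (D g) g).re = ‖CFC.sqrt D g‖ ^ 2 := by
    rw [h2, inner_apply_comm hB]
    exact inner_self_eq_norm_sq (𝕜 := ℂ) _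
  rw [h3, ← h1, ← mul_pow, h2]
  gcongr
  exact (CFC.sqrt D).le_opNorm _

/-- Monotone convergence of bounded positive operators. -/
theorem exists_tendsto_of_monotone_isPositive {R : ℝ → 𝓗 →L[ℂ] 𝓗}
    (hR : ∀ ε > 0, (R ε).IsPositive) (hR1 : ∀ ε > 0, ‖R ε‖ ≤ 1)
    (hmono : ∀ δ ε, 0 < δ → δ ≤ ε → ∀ g, (inner ℂ (R ε g) g).re ≤ (inner ℂ (R δ g) g).re) :
    ∃ R₀ : 𝓗 →L[ℂ] 𝓗, (∀ g, Tendsto (fun ε => R ε g) (𝓝[>] 0) (𝓝 (R₀ g))) ∧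
      R₀.IsPositive ∧ ‖R₀‖ ≤ 1 ∧
      ∀ ε > 0, ∀ g, (inner ℂ (R ε g) g).re ≤ (inner ℂ (R₀ g) g).re := by
  have hpos : ∀ᶠ ε : ℝ in 𝓝[>] 0, 0 < ε := eventually_mem_nhdsWithin
  have hdiff : ∀ δ ε, 0 < δ → δ ≤ ε → ∀ g,
      ‖R δ g - R ε g‖ ^ 2 ≤ 2 * ((inner ℂ (R δ g) g).re - (inner ℂ (R ε g) g).re) := by
    intro δ ε hδ hε g
    have hD : (R δ - R ε).IsPositive := by
      refine ⟨((hR δ hδ).isSymmetric.sub (hR ε (hδ.trans_le hε)).isSymmetric), fun g => ?_⟩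
      have := hmono δ ε hδ hε g
      rw [ContinuousLinearMap.reApplyInnerSelf_apply, sub_apply,
        inner_sub_left, map_sub]
      exact sub_nonneg.2 this
    refine (norm_apply_sq_le_of_isPositive hD g).trans ?_
    have h0 : 0 ≤ (inner ℂ (R δ g) g).re - (inner ℂ (R ε g) g).re :=
      sub_nonneg.2 (hmono δ ε hδ hε g)
    have h2 : ‖R δ - R ε‖ ≤ 2 :=
      (norm_sub_le _ _).trans (by linarith [hR1 δ hδ, hR1 ε (hδ.trans_le hε)])
    rw [sub_apply, inner_sub_left, Complex.sub_re]
    gcongr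
  have hlim : ∀ g, ∃ y, Tendsto (fun ε => R ε g) (𝓝[>] 0) (𝓝 y) := by
    intro g
    rw [← cauchy_map_iff_exists_tendsto, Metric.cauchy_iff]
    refine ⟨inferInstance, fun η hη => ?_⟩
    let Q : Set ℝ := (fun ε => (inner ℂ (R ε g) g).re) '' Set.Ioi 0
    have hbdd : BddAbove Q := by
      refine ⟨‖g‖ * ‖g‖, ?_⟩
      rintro _ ⟨ε, hε, rfl⟩
      refine (re_inner_le_norm (𝕜 := ℂ) _ _).trans ?_
      gcongr
      exact ((R ε).le_opNorm g).trans (mul_le_of_le_one_left (norm_nonneg _) (hR1 ε hε))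
    have hne : Q.Nonempty := ⟨_, 1, Set.mem_Ioi.2 one_pos, rfl⟩
    -- The constant is chosen so that 2 · η²/8 = (η/2)²; two such errors add up to less than η.
    obtain ⟨_, ⟨ε, hε, rfl⟩, hlt⟩ := exists_lt_of_lt_csSup hne
      (show sSup Q - η ^ 2 / 8 < sSup Q by linarith [sq_pos_of_pos hη])
    have hε0 : 0 < ε := hε
    have key : ∀ δ ∈ Set.Ioc 0 ε, ‖R δ g - R ε g‖ < η / 2 := by
      intro δ hδ
      have h1 := hdiff δ ε hδ.1 hδ.2 g
      have h2 : (inner ℂ (R δ g) g).re ≤ sSup Q := le_csSup hbdd ⟨δ, hδ.1, rfl⟩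
      have h3 : ‖R δ g - R ε g‖ ^ 2 < (η / 2) ^ 2 := by
        have h4 : sSup Q - η ^ 2 / 8 < (inner ℂ (R ε g) g).re := hlt
        nlinarith
      exact lt_of_pow_lt_pow_left₀ 2 (by positivity) h3
    refine ⟨(fun δ => R δ g) '' Set.Ioc 0 ε,
      image_mem_map (Ioc_mem_nhdsGT hε0), ?_⟩
    rintro _ ⟨δ, hδ, rfl⟩ _ ⟨δ', hδ', rfl⟩
    rw [dist_eq_norm]
    calc ‖R δ g - R δ' g‖ = ‖(R δ g - R ε g) - (R δ' g - R ε g)‖ := by congr 1; abel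
      _ ≤ ‖R δ g - R ε g‖ + ‖R δ' g - R ε g‖ := norm_sub_le _ _
      _ < η := by linarith [key δ hδ, key δ' hδ']
  choose L hL using hlim
  let L₀ : 𝓗 →ₗ[ℂ] 𝓗 := linearMapOfTendsto L (fun ε => (R ε).toLinearMap)
    (tendsto_pi_nhds.2 hL)
  have hL₀ : ∀ g, ‖L₀ g‖ ≤ 1 * ‖g‖ := fun g =>
    le_of_tendsto (hL g).norm (hpos.mono fun ε hε =>
      ((R ε).le_opNorm g).trans (by gcongr; exact hR1 ε hε))
  let R₀ : 𝓗 →L[ℂ] 𝓗 := L₀.mkContinuous 1 hL₀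
  have hR₀ : ∀ g, Tendsto (fun ε => R ε g) (𝓝[>] 0) (𝓝 (R₀ g)) := hL
  have hre : ∀ g, Tendsto (fun ε => (inner ℂ (R ε g) g).re) (𝓝[>] 0)
      (𝓝 (inner ℂ (R₀ g) g).re) := fun g =>
    (Complex.continuous_re.tendsto _).comp ((hR₀ g).inner tendsto_const_nhds)
  refine ⟨R₀, hR₀, ⟨fun f g => ?_, fun g => ?_⟩, L₀.mkContinuous_norm_le zero_le_one _,
    fun ε hε g => ?_⟩
  · refine tendsto_nhds_unique ((hR₀ f).inner (𝕜 := ℂ) (tendsto_const_nhds (x := g))) ?_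
    refine Tendsto.congr' ?_ ((tendsto_const_nhds (x := f)).inner (𝕜 := ℂ) (hR₀ g))
    exact hpos.mono fun ε hε => ((hR ε hε).isSymmetric f g).symm
  · exact ge_of_tendsto (hre g) (hpos.mono fun ε hε => (hR ε hε).re_inner_nonneg_left g)
  · refine ge_of_tendsto (hre g) ?_
    filter_upwards [Ioc_mem_nhdsGT hε] with δ hδ
    exact hmono δ ε hδ.1 hδ.2 g

namespace Form

theorem re_inner_resolvent {a : Form 𝓗} (ha : a.IsClosedPos) (g : 𝓗) :
    (inner ℂ (resolvent ha g) g).re = ‖(embed ha).adjoint g‖ ^ 2 := by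
  rw [inner_resolvent_self, Complex.ofReal_re]

theorem le_iff_re_inner_resolvent_le {a b : Form 𝓗} (ha : a.IsClosedPos) (hb : b.IsClosedPos) :
    b ≤ a ↔ ∀ g, (inner ℂ (resolvent ha g) g).re ≤ (inner ℂ (resolvent hb g) g).re := by
  simp_rw [re_inner_resolvent]
  constructor
  · intro h g
    have := norm_adjoint_le_of_le (ha := ha) (hb := hb) h g
    gcongr
  · intro h
    exact le_of_norm_adjoint_le (ha := ha) (hb := hb) fun g =>
      le_of_sq_le_sq (h g) (norm_nonneg _)

end Form

/-- The form of the strong resolvent limit of a monotone family of closed forms is the largest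
closed form below the family. -/
theorem isGreatest_formOf_resolventLimit {a : ℝ → Form 𝓗} (ha : ∀ ε > 0, (a ε).IsClosedPos)
    (hd : ∀ ε > 0, Dense ((a ε).domain : Set 𝓗)) (hmono : ∀ δ ε, 0 < δ → δ ≤ ε → a δ ≤ a ε) :
    (∀ ε > 0, formOf (resolventLimit fun ε => (a ε).operator) ≤ a ε) ∧
      ∀ b : Form 𝓗, b.IsClosedPos → (∀ ε > 0, b ≤ a ε) →
        b ≤ formOf (resolventLimit fun ε => (a ε).operator) := by
  classical
  -- The value for ε ≤ 0 is irrelevant, as the limit is taken from the right.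
  let R : ℝ → 𝓗 →L[ℂ] 𝓗 := fun ε => if h : 0 < ε then Form.resolvent (ha ε h) else 0
  have hR : ∀ ε (hε : 0 < ε), R ε = Form.resolvent (ha ε hε) := fun ε hε => dif_pos hε
  have hpos : ∀ᶠ ε : ℝ in 𝓝[>] 0, 0 < ε := eventually_mem_nhdsWithin
  obtain ⟨R₀, hlim, hR₀, hR₀1, hle⟩ := exists_tendsto_of_monotone_isPositive (R := R)
    (fun ε hε => hR ε hε ▸ Form.isPositive_resolvent _)
    (fun ε hε => hR ε hε ▸ Form.norm_resolvent_le _)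
    (fun δ ε hδ hε g => by
      rw [hR δ hδ, hR ε (hδ.trans_le hε)]
      exact (Form.le_iff_re_inner_resolvent_le _ _).1 (hmono δ ε hδ hε) g)
  -- The limit dominates the injective resolvent at ε = 1: if R₀g = 0 then (R₁g, g) ≤ 0, which
  -- forces R₁g = 0.
  have hinj : Function.Injective R₀ := by
    rw [injective_iff_map_eq_zero]
    intro g hg
    have h1 := hle 1 one_pos g
    rw [hg, inner_zero_left, Complex.zero_re, hR 1 one_pos] at h1
    have h2 := norm_apply_sq_le_of_isPositive (Form.isPositive_resolvent (ha 1 one_pos)) g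
    have h3 : ‖Form.resolvent (ha 1 one_pos) g‖ ^ 2 ≤ 0 :=
      h2.trans (mul_nonpos_of_nonneg_of_nonpos (norm_nonneg _) h1)
    refine (injective_iff_map_eq_zero _).1
      (Form.injective_resolvent (ha 1 one_pos) (hd 1 one_pos)) g ?_
    exact norm_eq_zero.1 (pow_eq_zero_iff two_ne_zero |>.1 (le_antisymm h3 (sq_nonneg _)))
  have hmem : ∀ φ f, (φ, f) ∈ resolventLimitGraph (fun ε => (a ε).operator) ↔
      R₀ (φ + f) = φ := by
    intro φ f
    constructor
    · rintro ⟨u, hu, hu'⟩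
      refine tendsto_nhds_unique (hlim (φ + f)) (Tendsto.congr' ?_ hu')
      refine hpos.mono fun ε hε => ?_
      have := (Form.mem_graph_operator_iff (ha ε hε) (hd ε hε)).1 (hu ε hε)
      rw [add_sub_cancel] at this
      exact ((DFunLike.congr_fun (hR ε hε) _).trans this).symm
    · intro h
      refine ⟨fun ε => R ε (φ + f), fun ε hε => ?_, ?_⟩
      · rw [Form.mem_graph_operator_iff (ha ε hε) (hd ε hε), add_sub_cancel]
        exact (DFunLike.congr_fun (hR ε hε) _).symm
      · have := hlim (φ + f)
        rwa [h] at this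
  have hgr : ∀ φ f, (φ, f) ∈ (resolventLimit fun ε => (a ε).operator).graph ↔
      R₀ (φ + f) = φ := by
    intro φ f
    rw [resolventLimit, Submodule.toLinearPMap_graph_eq, hmem]
    rintro ⟨x, f⟩ hx (rfl : x = 0)
    rw [hmem, zero_add] at hx
    exact (injective_iff_map_eq_zero _).1 hinj f hx
  have hres := resolvent_formOf hR₀ hR₀1 hinj hgr
  refine ⟨fun ε hε => ?_, fun b hb hba => ?_⟩
  · rw [Form.le_iff_re_inner_resolvent_le (ha ε hε) (isClosedPos_formOf _), hres, ← hR ε hε]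
    exact hle ε hε
  · rw [Form.le_iff_re_inner_resolvent_le (isClosedPos_formOf _) hb, hres]
    intro g
    refine le_of_tendsto ((Complex.continuous_re.tendsto _).comp
      ((hlim g).inner (𝕜 := ℂ) (tendsto_const_nhds (x := g)))) (hpos.mono fun ε hε => ?_)
    simp only [Function.comp_apply, hR ε hε]
    exact (Form.le_iff_re_inner_resolvent_le (ha ε hε) hb).1 (hba ε hε) g

end MonotoneLimit

/-! ### Values of combined forms and comparison of closed forms -/

namespace Form

variable {𝓗 : Type*} [NormedAddCommGroup 𝓗] [InnerProductSpace ℂ 𝓗] {a b : Form 𝓗}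

theorem value_add_form (φ : (a + b).domain) :
    (a + b).value φ = a.value ⟨φ, φ.2.1⟩ + b.value ⟨φ, φ.2.2⟩ := rfl

theorem value_smul_form (r : ℝ) (φ : (r • a).domain) : (r • a).value φ = r * a.value φ :=
  Complex.re_ofReal_mul _ _

theorem value_sub_form (φ : (a - b).domain) :
    (a - b).value φ = a.value ⟨φ, φ.2.1⟩ - b.value ⟨φ, φ.2.2⟩ := by
  change (a + (-1 : ℝ) • b).value φ = _
  rw [value_add_form, value_smul_form, neg_one_mul, ← sub_eq_add_neg]

theorem value_ident (φ : (ident : Form 𝓗).domain) : ident.value φ = ‖(φ : 𝓗)‖ ^ 2 :=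
  inner_self_eq_norm_sq (𝕜 := ℂ) (φ : 𝓗)

/-- A form which is comparable with a closed positive form on the same domain is closed. -/
theorem IsClosedPos.isClosed_of_le (hb : b.IsClosedPos) (hd : a.domain = b.domain)
    {m M : ℝ} (hm : 0 < m)
    (h1 : ∀ φ (hφ : φ ∈ a.domain), m * b.value ⟨φ, hd ▸ hφ⟩ ≤ a.value ⟨φ, hφ⟩)
    (h2 : ∀ φ (hφ : φ ∈ a.domain), a.value ⟨φ, hφ⟩ ≤ M * b.value ⟨φ, hd ▸ hφ⟩) :
    a.IsClosed := by
  intro u φ hu hc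
  have hpos : ∀ φ (hφ : φ ∈ a.domain), 0 ≤ a.value ⟨φ, hφ⟩ := fun φ hφ =>
    (mul_nonneg hm.le (hb.nonneg _)).trans (h1 φ hφ)
  obtain ⟨hφ, hlim⟩ := hb.closed (fun n => ⟨u n, hd ▸ (u n).2⟩) φ hu (by
    refine squeeze_zero (fun p => hb.nonneg _) (fun p => ?_)
      (by simpa using hc.const_mul m⁻¹)
    rw [← div_eq_inv_mul, le_div_iff₀' hm]
    exact h1 _ (u p.1 - u p.2).2)
  refine ⟨hd ▸ hφ, squeeze_zero (fun n => hpos _ (u n - ⟨φ, hd ▸ hφ⟩).2) (fun n => ?_)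
    (by simpa using hlim.const_mul M)⟩
  exact h2 _ (u n - ⟨φ, hd ▸ hφ⟩).2

/-- If two closed positive forms have the same domain and one is bounded by the other, then they
define equivalent norms. -/
theorem exists_value_le [CompleteSpace 𝓗] (ha : a.IsClosedPos) (hb : b.IsClosedPos)
    (hd : a.domain = b.domain) {M : ℝ}
    (h : ∀ φ (hφ : φ ∈ a.domain), a.value ⟨φ, hφ⟩ ≤ M * b.value ⟨φ, hd ▸ hφ⟩) :
    ∃ K : ℝ, 0 < K ∧ ∀ φ (hφ : φ ∈ a.domain),
      b.value ⟨φ, hd ▸ hφ⟩ ≤ K * (a.value ⟨φ, hφ⟩ + ‖φ‖ ^ 2) := by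
  let e : b.Space hb ≃ₗ[ℂ] a.Space ha :=
    (toSpace hb).symm.trans ((LinearEquiv.ofEq _ _ hd.symm).trans (toSpace ha))
  have he : ∀ φ (hφ : φ ∈ a.domain), e (toSpace hb ⟨φ, hd ▸ hφ⟩) = toSpace ha ⟨φ, hφ⟩ :=
    fun φ hφ => rfl
  -- In the bound below, `|M|` is used because the sign of `M` is unknown, and the added 1 absorbs
  -- the term ‖φ‖².
  have hcont : Continuous e := by
    suffices hle : ∀ φ (hφ : φ ∈ a.domain), ‖e (toSpace hb ⟨φ, hd ▸ hφ⟩)‖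
        ≤ √(|M| + 1) * ‖toSpace hb ⟨φ, hd ▸ hφ⟩‖ by
      refine AddMonoidHomClass.continuous_of_bound e (√(|M| + 1)) fun v => ?_
      obtain ⟨⟨φ, hφ⟩, rfl⟩ := (toSpace hb).surjective v
      exact hle φ (hd ▸ hφ)
    intro φ hφ
    refine le_of_sq_le_sq ?_ (by positivity)
    have h1 := h φ hφ
    rw [he φ hφ]
    generalize_proofs hφ' at h1 ⊢
    rw [mul_pow, Real.sq_sqrt (by positivity), norm_sq_toSpace (ha := ha) ⟨φ, hφ⟩,
      norm_sq_toSpace (ha := hb) ⟨φ, hφ'⟩]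
    have h2 := hb.nonneg ⟨φ, hφ'⟩
    have h3 := mul_le_mul_of_nonneg_right (le_abs_self M) h2
    have h4 := mul_nonneg (abs_nonneg M) (sq_nonneg ‖φ‖)
    nlinarith
  -- The open mapping theorem: a continuous linear bijection of Banach spaces has a continuous
  -- inverse.
  let E := e.toContinuousLinearEquivOfContinuous hcont
  refine ⟨‖(E.symm : a.Space ha →L[ℂ] b.Space hb)‖ ^ 2 + 1, by positivity, fun φ hφ => ?_⟩
  have h1 := (E.symm : a.Space ha →L[ℂ] b.Space hb).le_opNorm (toSpace ha ⟨φ, hφ⟩)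
  have h2 : (E.symm : a.Space ha →L[ℂ] b.Space hb) (toSpace ha ⟨φ, hφ⟩)
      = toSpace hb ⟨φ, hd ▸ hφ⟩ := rfl
  have h3 := pow_le_pow_left₀ (norm_nonneg _) h1 2
  rw [h2, mul_pow, norm_sq_toSpace, norm_sq_toSpace] at h3
  have h4 := ha.nonneg ⟨φ, hφ⟩
  have h5 : 0 ≤ ‖φ‖ ^ 2 := by positivity
  nlinarith

end Form

/-! ### Weak derivatives, the Sobolev space and the form of the Laplacian -/

variable {d : ℕ}

/-- Single-valuedness comes from the injectivity of the map from L² to tempered distributions. -/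
theorem mem_graph_partialDeriv_iff {i : Fin d} {φ ψ : L2 d} :
    (φ, ψ) ∈ (partialDeriv i).graph ↔
      ∂_{EuclideanSpace.single i (1 : ℝ)} (φ : 𝓢'(EuclideanSpace ℝ (Fin d), ℂ))
        = (ψ : 𝓢'(EuclideanSpace ℝ (Fin d), ℂ)) := by
  rw [partialDeriv, Submodule.toLinearPMap_graph_eq]
  · rfl
  · rintro ⟨x, f⟩ hx (rfl : x = 0)
    have h1 : ∂_{EuclideanSpace.single i (1 : ℝ)}
        (Lp.toTemperedDistributionCLM ℂ volume 2 (0 : L2 d))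
        = Lp.toTemperedDistributionCLM ℂ volume 2 f := hx
    rw [map_zero, LineDeriv.lineDerivOp_zero] at h1
    have h2 : f ∈ (Lp.toTemperedDistributionCLM ℂ (volume : Measure (EuclideanSpace ℝ (Fin d)))
      2).ker := h1.symm
    rw [Lp.ker_toTemperedDistributionCLM_eq_bot] at h2
    exact h2

/-- Differentiation and the embedding of L² are continuous into tempered distributions, so the graph
is an equalizer of continuous maps. -/
theorem isClosed_graph_partialDeriv (i : Fin d) :
    IsClosed ((partialDeriv i).graph : Set (L2 d × L2 d)) := by
  have : ((partialDeriv i).graph : Set (L2 d × L2 d)) =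
      {p | LineDeriv.lineDerivOpCLM ℂ 𝓢'(EuclideanSpace ℝ (Fin d), ℂ)
          (EuclideanSpace.single i (1 : ℝ)) (Lp.toTemperedDistributionCLM ℂ volume 2 p.1)
        = Lp.toTemperedDistributionCLM ℂ volume 2 p.2} := by
    ext ⟨φ, ψ⟩
    exact mem_graph_partialDeriv_iff
  rw [this]
  exact isClosed_eq (by fun_prop) (by fun_prop)

theorem mem_W12_of_forall {φ : L2 d} {ψ : Fin d → L2 d}
    (h : ∀ i, (φ, ψ i) ∈ (partialDeriv i).graph) :
    ∃ hφ : φ ∈ W12 d, ∀ i, grad i ⟨φ, hφ⟩ = ψ i := by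
  have hφ : φ ∈ W12 d := by
    rw [W12, Submodule.mem_iInf]
    exact fun i => LinearPMap.mem_domain_of_mem_graph (h i)
  refine ⟨hφ, fun i => ?_⟩
  exact (partialDeriv i).mem_graph_snd_inj
    ((partialDeriv i).mem_graph ⟨φ, LinearPMap.mem_domain_of_mem_graph (h i)⟩) (h i) rfl

theorem grad_mem_graph (i : Fin d) (φ : W12 d) : ((φ : L2 d), grad i φ) ∈ (partialDeriv i).graph :=
  (partialDeriv i).mem_graph ⟨φ, (Submodule.mem_iInf _).1 φ.2 i⟩

/-- Schwartz functions belong to `W^{1,2}`, with the classical partial derivatives. -/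
theorem toLp_mem_W12 (f : 𝓢(EuclideanSpace ℝ (Fin d), ℂ)) :
    ∃ hf : f.toLp 2 volume ∈ W12 d, ∀ i, grad i ⟨f.toLp 2 volume, hf⟩
      = SchwartzMap.toLp
        (∂_{EuclideanSpace.single i (1 : ℝ)} f : 𝓢(EuclideanSpace ℝ (Fin d), ℂ)) 2 volume := by
  refine mem_W12_of_forall fun i => ?_
  rw [mem_graph_partialDeriv_iff, Lp.toTemperedDistribution_toLp_eq,
    Lp.toTemperedDistribution_toLp_eq,
    TemperedDistribution.lineDerivOp_toTemperedDistributionCLM_eq]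

theorem dense_W12 : Dense (W12 d : Set (L2 d)) := by
  refine (SchwartzMap.denseRange_toLpCLM (p := 2) (μ := volume) ENNReal.ofNat_ne_top).mono ?_
  rintro _ ⟨f, rfl⟩
  exact (toLp_mem_W12 f).1

theorem sesq_laplaceForm {φ ψ : L2 d} (hφ : φ ∈ W12 d) (hψ : ψ ∈ W12 d) :
    (laplaceForm d).sesq ⟨φ, hφ⟩ ⟨ψ, hψ⟩ = ∑ i, inner ℂ (grad i ⟨φ, hφ⟩) (grad i ⟨ψ, hψ⟩) := by
  have h : ∀ φ ψ : W12 d, (∑ i : Fin d, pullback (innerₛₗ ℂ) (grad i)) φ ψ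
      = ∑ i, inner ℂ (grad i φ) (grad i ψ) := fun φ ψ => by
    rw [LinearMap.sum_apply, LinearMap.sum_apply]
    rfl
  exact h ⟨φ, hφ⟩ ⟨ψ, hψ⟩

theorem value_laplaceForm {φ : L2 d} (hφ : φ ∈ W12 d) :
    (laplaceForm d).value ⟨φ, hφ⟩ = ∑ i, ‖grad i ⟨φ, hφ⟩‖ ^ 2 := by
  rw [Form.value, sesq_laplaceForm hφ hφ, Complex.re_sum]
  exact Finset.sum_congr rfl fun i _ => inner_self_eq_norm_sq (𝕜 := ℂ) _

theorem isClosedPos_laplaceForm : (laplaceForm d).IsClosedPos where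
  symm φ ψ := by
    rw [← Subtype.coe_eta φ φ.2, ← Subtype.coe_eta ψ ψ.2, sesq_laplaceForm φ.2 ψ.2,
      sesq_laplaceForm ψ.2 φ.2, map_sum]
    exact Finset.sum_congr rfl fun i _ => inner_conj_symm _ _
  nonneg φ := (value_laplaceForm φ.2).symm ▸ by positivity
  closed := by
    -- The whole gradient as one operator into the ℓ² sum, whose squared norm is l.
    let T : W12 d →ₗ[ℂ] PiLp 2 fun _ : Fin d => L2 d :=
      (WithLp.linearEquiv 2 ℂ (Fin d → L2 d)).symm.toLinearMap ∘ₗ LinearMap.pi grad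
    refine Form.isClosed_of_value_eq T (fun φ => ?_) fun u φ y hu hy => ?_
    · exact (value_laplaceForm φ.2).trans (PiLp.norm_sq_eq_of_L2 _ (T φ)).symm
    · have h1 : ∀ i, (φ, y i) ∈ (partialDeriv i).graph := fun i => by
        have hyi : Tendsto (fun n => grad i (u n)) atTop (𝓝 (y i)) :=
          ((PiLp.continuous_apply 2 _ i).tendsto y).comp hy
        exact (isClosed_graph_partialDeriv i).mem_of_tendsto (hu.prodMk_nhds hyi)
          (Eventually.of_forall fun n => grad_mem_graph i (u n))
      obtain ⟨hφ, hφ'⟩ := mem_W12_of_forall h1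
      exact ⟨hφ, PiLp.ext fun i => hφ' i⟩

/-! ### The energy density and the elliptic form -/

/-- The density `∑ᵢⱼ cᵢⱼ Re(z̄ᵢ zⱼ)` of the elliptic form. -/
def energy (M : Matrix (Fin d) (Fin d) ℝ) (z : Fin d → ℂ) : ℝ :=
  ∑ i, ∑ j, (conj (z i) * (M i j : ℂ) * z j).re

/-- Since `M` is real, real and imaginary parts decouple term by term; this reduces complex vectors
to real ones. -/
theorem energy_eq (M : Matrix (Fin d) (Fin d) ℝ) (z : Fin d → ℂ) :
    energy M z = ∑ i, ∑ j, M i j * ((z i).re * (z j).re + (z i).im * (z j).im) := by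
  refine Finset.sum_congr rfl fun i _ => Finset.sum_congr rfl fun j _ => ?_
  simp
  ring

theorem energy_nonneg {M : Matrix (Fin d) (Fin d) ℝ} (hM : M.PosSemidef) (z : Fin d → ℂ) :
    0 ≤ energy M z := by
  have h := fun x => hM.dotProduct_mulVec_nonneg x
  have h1 := add_nonneg (h fun i => (z i).re) (h fun i => (z i).im)
  refine h1.trans_eq ?_
  rw [energy_eq]
  simp only [dotProduct, Matrix.mulVec, Finset.mul_sum, ← Finset.sum_add_distrib, Pi.star_apply,
    star_trivial]
  exact Finset.sum_congr rfl fun i _ => Finset.sum_congr rfl fun j _ => by ring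

theorem energy_sub_smul_one (M : Matrix (Fin d) (Fin d) ℝ) (μ : ℝ) (z : Fin d → ℂ) :
    energy (M - μ • (1 : Matrix (Fin d) (Fin d) ℝ)) z = energy M z - μ * ∑ i, ‖z i‖ ^ 2 := by
  rw [energy_eq, energy_eq, Finset.mul_sum, ← Finset.sum_sub_distrib]
  refine Finset.sum_congr rfl fun i _ => ?_
  have : ‖z i‖ ^ 2 = (z i).re * (z i).re + (z i).im * (z i).im := by
    rw [Complex.sq_norm, Complex.normSq_apply]
  simp [Matrix.sub_apply, Matrix.smul_apply, Matrix.one_apply, sub_mul, this]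

theorem integrable_energy (C : Coefficients d) (f : Fin d → L2 d) :
    Integrable (fun x => energy (C.mat x) fun i => f i x) := by
  refine integrable_finsetSum _ fun i _ => integrable_finsetSum _ fun j _ => ?_
  exact (integrable_term C i j (f i) (f j)).re

theorem sesq_ellipticForm (C : Coefficients d) {φ ψ : L2 d} (hφ : φ ∈ W12 d) (hψ : ψ ∈ W12 d) :
    (ellipticForm C).sesq ⟨φ, hφ⟩ ⟨ψ, hψ⟩ = ∑ i, ∑ j,
      ∫ x, conj (grad i ⟨φ, hφ⟩ x) * (C.mat x i j : ℂ) * grad j ⟨ψ, hψ⟩ x := rfl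

theorem value_ellipticForm (C : Coefficients d) {φ : L2 d} (hφ : φ ∈ W12 d) :
    (ellipticForm C).value ⟨φ, hφ⟩ = ∫ x, energy (C.mat x) fun i => grad i ⟨φ, hφ⟩ x := by
  have hint : ∀ i j, Integrable
      (fun x => (conj (grad i ⟨φ, hφ⟩ x) * (C.mat x i j : ℂ) * grad j ⟨φ, hφ⟩ x).re) :=
    fun i j => (integrable_term C i j (grad i ⟨φ, hφ⟩) (grad j ⟨φ, hφ⟩)).re
  have h1 : ∫ x, energy (C.mat x) (fun i => grad i ⟨φ, hφ⟩ x) = ∑ i, ∑ j,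
      ∫ x, (conj (grad i ⟨φ, hφ⟩ x) * (C.mat x i j : ℂ) * grad j ⟨φ, hφ⟩ x).re := by
    simp_rw [energy]
    rw [integral_finsetSum _ fun i _ => integrable_finsetSum _ fun j _ => hint i j]
    exact Finset.sum_congr rfl fun i _ => integral_finsetSum _ fun j _ => hint i j
  rw [h1, Form.value, sesq_ellipticForm C hφ hφ, Complex.re_sum]
  simp_rw [Complex.re_sum]
  exact Finset.sum_congr rfl fun i _ => Finset.sum_congr rfl fun j _ =>
    (integral_re (integrable_term C i j _ _)).symm

theorem integrable_norm_sq (f : L2 d) : Integrable (fun x => ‖f x‖ ^ 2) :=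
  (memLp_two_iff_integrable_sq_norm (Lp.aestronglyMeasurable f)).1 (Lp.memLp f)

theorem norm_sq_eq_integral (f : L2 d) : ‖f‖ ^ 2 = ∫ x, ‖f x‖ ^ 2 := by
  rw [← inner_self_eq_norm_sq (𝕜 := ℂ), L2.inner_def, ← integral_re]
  · exact integral_congr_ae (Eventually.of_forall fun x => inner_self_eq_norm_sq (𝕜 := ℂ) _)
  · exact L2.integrable_inner f f

theorem value_laplaceForm_eq_integral {φ : L2 d} (hφ : φ ∈ W12 d) :
    (laplaceForm d).value ⟨φ, hφ⟩ = ∫ x, ∑ i, ‖grad i ⟨φ, hφ⟩ x‖ ^ 2 := by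
  rw [value_laplaceForm hφ, integral_finsetSum _ fun i _ => integrable_norm_sq _]
  exact Finset.sum_congr rfl fun i _ => norm_sq_eq_integral _

theorem symm_ellipticForm (C : Coefficients d) (φ ψ : (ellipticForm C).domain) :
    conj ((ellipticForm C).sesq φ ψ) = (ellipticForm C).sesq ψ φ := by
  rw [← Subtype.coe_eta φ φ.2, ← Subtype.coe_eta ψ ψ.2, sesq_ellipticForm C φ.2 ψ.2,
    sesq_ellipticForm C ψ.2 φ.2]
  simp only [map_sum]
  rw [Finset.sum_comm]
  refine Finset.sum_congr rfl fun i _ => Finset.sum_congr rfl fun j _ => ?_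
  rw [← integral_conj]
  refine integral_congr_ae ?_
  filter_upwards [C.posSemidef] with x hx
  have : C.mat x j i = C.mat x i j := by simpa using hx.1.apply i j
  simp only [map_mul, Complex.conj_conj, Complex.conj_ofReal, this]
  ring

theorem nonneg_ellipticForm (C : Coefficients d) (φ : (ellipticForm C).domain) :
    0 ≤ (ellipticForm C).value φ := by
  refine (integral_nonneg_of_ae ?_).trans_eq (value_ellipticForm C φ.2).symm
  filter_upwards [C.posSemidef] with x hx
  exact energy_nonneg hx _

/-- Ellipticity of the coefficients gives ellipticity of the form. -/
theorem mul_value_laplaceForm_le {C : Coefficients d} {μ : ℝ}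
    (h : ∀ᵐ x, (C.mat x - μ • (1 : Matrix (Fin d) (Fin d) ℝ)).PosSemidef)
    {φ : L2 d} (hφ : φ ∈ W12 d) :
    μ * (laplaceForm d).value ⟨φ, hφ⟩ ≤ (ellipticForm C).value ⟨φ, hφ⟩ := by
  rw [value_ellipticForm C hφ, value_laplaceForm_eq_integral hφ, ← integral_const_mul]
  refine integral_mono_ae ((integrable_finsetSum _ fun i _ => integrable_norm_sq _).const_mul μ)
    (integrable_energy C _) ?_
  filter_upwards [h] with x hx
  have := energy_nonneg hx fun i => grad i ⟨φ, hφ⟩ x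
  rw [energy_sub_smul_one] at this
  exact sub_nonneg.1 this

theorem exists_energy_le (C : Coefficients d) :
    ∃ K : ℝ, ∀ᵐ x, ∀ z, energy (C.mat x) z ≤ K * ∑ i, ‖z i‖ ^ 2 := by
  have h1 : ∀ i j, ∃ K : ℝ, ∀ᵐ x, ‖C.mat x i j‖ ≤ K := fun i j =>
    ⟨_, ae_le_lpNorm_exponent_top (C.bounded i j)⟩
  choose K hK using h1
  refine ⟨∑ i, ∑ j, K i j, ?_⟩
  filter_upwards [ae_all_iff.2 fun i => ae_all_iff.2 fun j => hK i j] with x hx z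
  rw [energy, Finset.sum_mul]
  refine Finset.sum_le_sum fun i _ => ?_
  rw [Finset.sum_mul]
  refine Finset.sum_le_sum fun j _ => ?_
  have hs : ∀ k, ‖z k‖ ^ 2 ≤ ∑ i, ‖z i‖ ^ 2 := fun k =>
    Finset.single_le_sum (f := fun i => ‖z i‖ ^ 2) (fun i _ => by positivity) (Finset.mem_univ k)
  have hz : ‖z i‖ * ‖z j‖ ≤ ∑ i, ‖z i‖ ^ 2 := by
    nlinarith [hs i, hs j, sq_nonneg (‖z i‖ - ‖z j‖)]
  calc (conj (z i) * (C.mat x i j : ℂ) * z j).re ≤ ‖conj (z i) * (C.mat x i j : ℂ) * z j‖ :=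
        Complex.re_le_norm _
    _ = ‖C.mat x i j‖ * (‖z i‖ * ‖z j‖) := by
        rw [norm_mul, norm_mul, RCLike.norm_conj, Complex.norm_real]; ring
    _ ≤ K i j * ∑ i, ‖z i‖ ^ 2 := by
        gcongr
        exacts [(norm_nonneg _).trans (hx i j), hx i j]

theorem exists_value_ellipticForm_le (C : Coefficients d) :
    ∃ M : ℝ, ∀ φ (hφ : φ ∈ W12 d),
      (ellipticForm C).value ⟨φ, hφ⟩ ≤ M * (laplaceForm d).value ⟨φ, hφ⟩ := by
  obtain ⟨K, hK⟩ := exists_energy_le C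
  refine ⟨K, fun φ hφ => ?_⟩
  rw [value_ellipticForm C hφ, value_laplaceForm_eq_integral hφ, ← integral_const_mul]
  refine integral_mono_ae (integrable_energy C _)
    ((integrable_finsetSum _ fun i _ => integrable_norm_sq _).const_mul K) ?_
  filter_upwards [hK] with x hx
  exact hx _

theorem isClosedPos_ellipticForm {C : Coefficients d} (h : (ellipticForm C).IsClosed) :
    (ellipticForm C).IsClosedPos :=
  ⟨symm_ellipticForm C, nonneg_ellipticForm C, h⟩

/-! ### The regularized forms and the viscosity form -/

theorem domain_regularized (C : Coefficients d) (ε : ℝ) :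
    (ellipticForm C + ε • laplaceForm d).domain = W12 d := inf_idem (W12 d)

theorem isClosedPos_regularized (C : Coefficients d) {ε : ℝ} (hε : 0 < ε) :
    (ellipticForm C + ε • laplaceForm d).IsClosedPos where
  symm φ ψ := by
    change conj ((ellipticForm C).sesq ⟨φ, φ.2.1⟩ ⟨ψ, ψ.2.1⟩
      + (ε : ℂ) * (laplaceForm d).sesq ⟨φ, φ.2.2⟩ ⟨ψ, ψ.2.2⟩) =
      (ellipticForm C).sesq ⟨ψ, ψ.2.1⟩ ⟨φ, φ.2.1⟩
      + (ε : ℂ) * (laplaceForm d).sesq ⟨ψ, ψ.2.2⟩ ⟨φ, φ.2.2⟩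
    rw [map_add, map_mul, Complex.conj_ofReal]
    exact congrArg₂ (· + ·) (symm_ellipticForm C _ _)
      (congrArg _ (isClosedPos_laplaceForm.symm _ _))
  nonneg φ := by
    rw [Form.value_add_form, Form.value_smul_form]
    exact add_nonneg (nonneg_ellipticForm C _)
      (mul_nonneg hε.le (isClosedPos_laplaceForm.nonneg _))
  closed := by
    obtain ⟨M, hM⟩ := exists_value_ellipticForm_le C
    refine isClosedPos_laplaceForm.isClosed_of_le (domain_regularized C ε) hε (M := M + ε)
      (fun φ hφ => ?_) fun φ hφ => ?_
    · rw [Form.value_add_form, Form.value_smul_form]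
      exact le_add_of_nonneg_left (nonneg_ellipticForm C _)
    · rw [Form.value_add_form, Form.value_smul_form, add_mul]
      exact add_le_add_left (hM φ _) _

theorem viscosityForm_le_regularized (C : Coefficients d) :
    (∀ ε > 0, viscosityForm C ≤ ellipticForm C + (ε : ℝ) • laplaceForm d) ∧
      ∀ b : Form (L2 d), b.IsClosedPos →
        (∀ ε > 0, b ≤ ellipticForm C + (ε : ℝ) • laplaceForm d) → b ≤ viscosityForm C := by
  refine isGreatest_formOf_resolventLimit (fun ε hε => isClosedPos_regularized C hε)
    (fun ε _ => ?_) fun δ ε hδ hδε => ⟨le_rfl, fun φ => ?_⟩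
  · rw [domain_regularized]
    exact dense_W12
  · rw [Form.value_add_form, Form.value_add_form, Form.value_smul_form, Form.value_smul_form]
    exact add_le_add_right
      (mul_le_mul_of_nonneg_right hδε (isClosedPos_laplaceForm.nonneg _)) _

/-- The viscosity form is dominated by the elliptic form. -/
theorem viscosityForm_le (C : Coefficients d) : viscosityForm C ≤ ellipticForm C := by
  have h := (viscosityForm_le_regularized C).1
  obtain ⟨hd, -⟩ := h 1 one_pos
  rw [domain_regularized] at hd
  refine ⟨hd, fun φ => ?_⟩
  -- All the regularized forms share one domain, so φ stays fixed while ε ↓ 0.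
  have key : ∀ ε : ℝ, 0 < ε → (viscosityForm C).value ⟨φ, hd φ.2⟩
      ≤ (ellipticForm C).value φ + ε * (laplaceForm d).value φ := fun ε hε =>
    ((h ε hε).2 ⟨φ, φ.2, φ.2⟩).trans_eq (by
      rw [Form.value_add_form, Form.value_smul_form]
      rfl)
  have hlim : Tendsto (fun ε : ℝ => (ellipticForm C).value φ + ε * (laplaceForm d).value φ)
      (𝓝[>] 0) (𝓝 ((ellipticForm C).value φ + 0 * (laplaceForm d).value φ)) :=
    (tendsto_const_nhds.add (tendsto_id.mul_const _)).mono_left nhdsWithin_le_nhds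
  rw [zero_mul, add_zero] at hlim
  exact ge_of_tendsto hlim (eventually_mem_nhdsWithin.mono fun ε hε => key ε hε)

/-- If the elliptic form is closed, then it is the viscosity form. -/
theorem ellipticForm_eq_viscosityForm {C : Coefficients d} (h : (ellipticForm C).IsClosed) :
    ellipticForm C = viscosityForm C := by
  refine Form.le_antisymm_of_symm (symm_ellipticForm C) (isClosedPos_formOf _).symm ?_
    (viscosityForm_le C)
  -- Once closed, h is itself a competitor in the maximality of h₀, because h ≤ h + εl.
  refine (viscosityForm_le_regularized C).2 _ (isClosedPos_ellipticForm h) fun ε hε =>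
    ⟨inf_le_left, fun φ => ?_⟩
  rw [Form.value_add_form, Form.value_smul_form]
  exact le_add_of_nonneg_right (mul_nonneg (le_of_lt hε) (isClosedPos_laplaceForm.nonneg _))

theorem formOf_laplacian : formOf (laplacian d) = laplaceForm d :=
  formOf_operator isClosedPos_laplaceForm dense_W12

/-! ### From integrals against squares to pointwise bounds -/

section Localization

variable {E : Type*} [NormedAddCommGroup E] [NormedSpace ℝ E] [FiniteDimensional ℝ E]
  [MeasurableSpace E] [BorelSpace E] {ν : Measure E} [IsFiniteMeasureOnCompacts ν]

/-- A bounded function is nonnegative if its integrals against squares of test functions are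
nonnegative. -/
theorem ae_nonneg_of_integral_sq_mul_nonneg {F : E → ℝ} (hF : MemLp F ∞ ν)
    (h : ∀ g : E → ℝ, ContDiff ℝ (⊤ : ℕ∞) g → HasCompactSupport g → 0 ≤ ∫ x, g x ^ 2 * F x ∂ν) :
    0 ≤ᵐ[ν] F := by
  -- Multiplication by F is bounded on L², so (u, Au) ≥ 0 extends from test functions to all u by
  -- density; indicator functions then give nonnegative set integrals.
  let A : Lp ℝ 2 ν →L[ℝ] Lp ℝ 2 ν :=
    (ContinuousLinearMap.mul ℝ ℝ).holderL ν ∞ 2 2 (hF.toLp F)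
  have hA : ∀ u : Lp ℝ 2 ν, (A u : E → ℝ) =ᵐ[ν] fun x => F x * u x := by
    intro u
    filter_upwards [(ContinuousLinearMap.mul ℝ ℝ).coeFn_holder (r := 2) (hF.toLp F) u,
      hF.coeFn_toLp] with x h1 h2
    exact h1.trans (by rw [h2]; rfl)
  have hinner : ∀ u : Lp ℝ 2 ν, inner ℝ u (A u) = ∫ x, u x ^ 2 * F x ∂ν := by
    intro u
    rw [L2.inner_def]
    refine integral_congr_ae ?_
    filter_upwards [hA u] with x hx
    rw [hx]
    simp
    ring
  have hnonneg : ∀ u : Lp ℝ 2 ν, 0 ≤ inner ℝ u (A u) := by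
    have hclosed : IsClosed {u : Lp ℝ 2 ν | 0 ≤ inner ℝ u (A u)} :=
      isClosed_le continuous_const (continuous_id.inner A.continuous)
    intro u
    refine hclosed.closure_subset_iff.2 subset_rfl
      ((mem_closure_iff_nhds_basis Metric.nhds_basis_closedBall).2 fun η hη => ?_)
    obtain ⟨g, hg₁, hg₂, hg₃⟩ := MemLp.exist_eLpNorm_sub_le (p := 2) (by simp) (by simp)
      (Lp.memLp u) hη
    have hg : MemLp g 2 ν := hg₂.continuous.memLp_of_hasCompactSupport hg₁
    refine ⟨hg.toLp g, ?_, ?_⟩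
    · rw [Set.mem_ofPred_eq, hinner]
      refine (h g hg₂ hg₁).trans_eq (integral_congr_ae ?_)
      filter_upwards [hg.coeFn_toLp] with x hx
      rw [hx]
    · have : (u : E → ℝ) - (hg.toLp g : E → ℝ) =ᵐ[ν] (u : E → ℝ) - g := by
        filter_upwards [hg.coeFn_toLp] with x hx
        simp [hx]
      rw [Metric.mem_closedBall', Lp.dist_def, eLpNorm_congr_ae this]
      exact ENNReal.toReal_le_of_le_ofReal hη.le hg₃
  have hint : ∀ s, MeasurableSet s → ν s < ∞ → IntegrableOn F s ν := fun s _ hs => by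
    have : IsFiniteMeasure (ν.restrict s) := isFiniteMeasure_restrict.2 hs.ne
    exact (hF.restrict s).integrable le_top
  refine ae_nonneg_of_forall_setIntegral_nonneg_of_sigmaFinite hint fun s hs hνs => ?_
  have h1 := hnonneg (indicatorConstLp 2 hs hνs.ne 1)
  rw [hinner, ← integral_indicator hs] at *
  refine h1.trans_eq (integral_congr_ae ?_)
  filter_upwards [indicatorConstLp_coeFn (p := 2) (hs := hs) (hμs := hνs.ne) (c := (1 : ℝ))]
    with x hx
  rw [hx]
  by_cases hxs : x ∈ s <;> simp [hxs]

end Localization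

/-! ### Modulated test functions -/

theorem energy_mul_unimodular (M : Matrix (Fin d) (Fin d) ℝ) (z : Fin d → ℂ) {c : ℂ}
    (hc : ‖c‖ = 1) : energy M (fun i => z i * c) = energy M z := by
  have : conj c * c = 1 := by
    rw [← Complex.normSq_eq_conj_mul_self, Complex.normSq_eq_norm_sq, hc]
    simp
  refine Finset.sum_congr rfl fun i _ => Finset.sum_congr rfl fun j _ => ?_
  congr 1
  rw [map_mul]
  linear_combination (conj (z i) * (M i j : ℂ) * z j) * this

/-- Applied to the gradient (∇χ + ikχξ)e^{ikξ·x}, after the phase is dropped, this leaves no term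
linear in k. -/
theorem energy_add_I_mul (M : Matrix (Fin d) (Fin d) ℝ) (a b : Fin d → ℝ) :
    energy M (fun i => (a i : ℂ) + b i * Complex.I)
      = energy M (fun i => (a i : ℂ)) + energy M (fun i => (b i : ℂ)) := by
  simp only [energy_eq, ← Finset.sum_add_distrib]
  refine Finset.sum_congr rfl fun i _ => Finset.sum_congr rfl fun j _ => ?_
  simp
  ring

theorem energy_ofReal (M : Matrix (Fin d) (Fin d) ℝ) (a : Fin d → ℝ) :
    energy M (fun i => (a i : ℂ)) = a ⬝ᵥ M.mulVec a := by
  simp only [energy_eq, dotProduct, Matrix.mulVec, Finset.mul_sum]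
  refine Finset.sum_congr rfl fun i _ => Finset.sum_congr rfl fun j _ => ?_
  simp
  ring

/-- The test function `χ(x) exp(i k ξ·x)`. -/
def modulate (χ : EuclideanSpace ℝ (Fin d) → ℝ) (ξ : EuclideanSpace ℝ (Fin d)) (k : ℝ)
    (x : EuclideanSpace ℝ (Fin d)) : ℂ :=
  χ x * Complex.exp ((k * inner ℝ ξ x : ℝ) * Complex.I)

theorem norm_modulate (χ : EuclideanSpace ℝ (Fin d) → ℝ) (ξ : EuclideanSpace ℝ (Fin d)) (k : ℝ)
    (x : EuclideanSpace ℝ (Fin d)) : ‖modulate χ ξ k x‖ ^ 2 = χ x ^ 2 := by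
  rw [modulate, norm_mul, Complex.norm_exp_ofReal_mul_I, mul_one, Complex.norm_real,
    Real.norm_eq_abs, sq_abs]

theorem contDiff_modulate {χ : EuclideanSpace ℝ (Fin d) → ℝ} (hχ : ContDiff ℝ (⊤ : ℕ∞) χ)
    (ξ : EuclideanSpace ℝ (Fin d)) (k : ℝ) : ContDiff ℝ (⊤ : ℕ∞) (modulate χ ξ k) := by
  unfold modulate
  have h1 : ContDiff ℝ (⊤ : ℕ∞) fun x => ((χ x : ℝ) : ℂ) := Complex.ofRealCLM.contDiff.comp hχ
  have h2 : ContDiff ℝ (⊤ : ℕ∞) fun x : EuclideanSpace ℝ (Fin d) => ((k * inner ℝ ξ x : ℝ) : ℂ) :=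
    Complex.ofRealCLM.contDiff.comp (contDiff_const.mul (contDiff_const.inner ℝ contDiff_id))
  exact h1.mul (h2.mul contDiff_const).cexp

theorem hasCompactSupport_modulate {χ : EuclideanSpace ℝ (Fin d) → ℝ} (hχ : HasCompactSupport χ)
    (ξ : EuclideanSpace ℝ (Fin d)) (k : ℝ) : HasCompactSupport (modulate χ ξ k) :=
  (hχ.comp_left (g := ((↑) : ℝ → ℂ)) Complex.ofReal_zero).mul_right

theorem fderiv_modulate {χ : EuclideanSpace ℝ (Fin d) → ℝ} (hχ : ContDiff ℝ (⊤ : ℕ∞) χ)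
    (ξ : EuclideanSpace ℝ (Fin d)) (k : ℝ) (x v : EuclideanSpace ℝ (Fin d)) :
    fderiv ℝ (modulate χ ξ k) x v =
      ((fderiv ℝ χ x v : ℝ) + (k * (inner ℝ ξ v * χ x) : ℝ) * Complex.I)
      * Complex.exp ((k * inner ℝ ξ x : ℝ) * Complex.I) := by
  have h0 : HasFDerivAt χ (fderiv ℝ χ x) x :=
    (hχ.differentiable (by simp) x).hasFDerivAt
  have h1 : HasFDerivAt (fun x => ((χ x : ℝ) : ℂ)) (Complex.ofRealCLM ∘L fderiv ℝ χ x) x :=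
    Complex.ofRealCLM.hasFDerivAt.comp x h0
  have h2 : HasFDerivAt (fun x : EuclideanSpace ℝ (Fin d) => ((k * inner ℝ ξ x : ℝ) : ℂ))
      (Complex.ofRealCLM ∘L (k • innerSL ℝ ξ)) x :=
    Complex.ofRealCLM.hasFDerivAt.comp x ((innerSL ℝ ξ).hasFDerivAt.const_mul k)
  have h3 := h1.mul (h2.mul_const Complex.I).cexp
  have h4 : fderiv ℝ (modulate χ ξ k) x = _ := h3.fderiv
  rw [h4]
  simp
  ring

theorem memLp_top_quadratic (C : Coefficients d) (μ : ℝ) (ξ : Fin d → ℝ) :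
    MemLp (fun x => ξ ⬝ᵥ (C.mat x - μ • (1 : Matrix (Fin d) (Fin d) ℝ)).mulVec ξ) ∞ volume := by
  have h : ∀ i j, MemLp (fun x => (C.mat x - μ • (1 : Matrix (Fin d) (Fin d) ℝ)) i j) ∞ volume :=
    fun i j => (C.bounded i j).sub (memLp_top_const _)
  simp only [dotProduct, Matrix.mulVec, Finset.mul_sum]
  exact memLp_finsetSum _ fun i _ => memLp_finsetSum _ fun j _ =>
    ((h i j).mul_const (ξ j)).const_mul (ξ i)

/-- Testing a lower bound of the form on modulated test functions. -/
theorem integral_sq_mul_quadratic_nonneg {C : Coefficients d} {μ ν : ℝ}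
    (h : ∀ φ (hφ : φ ∈ W12 d), μ * (laplaceForm d).value ⟨φ, hφ⟩ - ν * ‖φ‖ ^ 2
      ≤ (ellipticForm C).value ⟨φ, hφ⟩) (ξ : EuclideanSpace ℝ (Fin d))
    {χ : EuclideanSpace ℝ (Fin d) → ℝ} (hχ : ContDiff ℝ (⊤ : ℕ∞) χ) (hχc : HasCompactSupport χ) :
    0 ≤ ∫ x, χ x ^ 2 *
      (ξ.ofLp ⬝ᵥ (C.mat x - μ • (1 : Matrix (Fin d) (Fin d) ℝ)).mulVec ξ.ofLp) := by
  let f : ℝ → 𝓢(EuclideanSpace ℝ (Fin d), ℂ) := fun k =>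
    (hasCompactSupport_modulate hχc ξ k).toSchwartzMap (contDiff_modulate hχ ξ k)
  have hf : ∀ k x, f k x = modulate χ ξ k x := fun k x => rfl
  choose hW hgrad using fun k => toLp_mem_W12 (f k)
  let M : EuclideanSpace ℝ (Fin d) → Matrix (Fin d) (Fin d) ℝ :=
    fun x => C.mat x - μ • (1 : Matrix (Fin d) (Fin d) ℝ)
  let G : ℝ → EuclideanSpace ℝ (Fin d) → ℝ := fun k x =>
    energy (M x) fun i => grad i ⟨(f k).toLp 2 volume, hW k⟩ x
  let a : EuclideanSpace ℝ (Fin d) → ℝ := fun x =>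
    energy (M x) fun i => ((fderiv ℝ χ x (EuclideanSpace.single i 1) : ℝ) : ℂ)
  let q : EuclideanSpace ℝ (Fin d) → ℝ := fun x => ξ.ofLp ⬝ᵥ (M x).mulVec ξ.ofLp
  -- The energy for C − μI is an exact quadratic in k, with the desired integrand as leading
  -- coefficient.
  have hG : ∀ k, G k =ᵐ[volume] fun x => a x + k ^ 2 * (χ x ^ 2 * q x) := by
    intro k
    have h1 : ∀ᵐ x, ∀ i, grad i ⟨(f k).toLp 2 volume, hW k⟩ x
        = fderiv ℝ (modulate χ ξ k) x (EuclideanSpace.single i 1) := by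
      refine ae_all_iff.2 fun i => ?_
      rw [hgrad k i]
      exact SchwartzMap.coeFn_toLp _ 2 volume
    filter_upwards [h1] with x hx
    simp only [G, hx, fderiv_modulate hχ]
    rw [energy_mul_unimodular _ _ (Complex.norm_exp_ofReal_mul_I _), energy_add_I_mul]
    congr 1
    have : (fun i : Fin d => k * (inner ℝ ξ (EuclideanSpace.single i (1 : ℝ)) * χ x))
        = (k * χ x) • ξ.ofLp := by
      ext i
      simp [EuclideanSpace.inner_single_right]
      ring
    rw [energy_ofReal, this, Matrix.mulVec_smul, dotProduct_smul, smul_dotProduct]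
    simp only [smul_eq_mul, q]
    ring
  have hGint : ∀ k, Integrable (G k) := by
    intro k
    simp only [G, M, energy_sub_smul_one]
    exact (integrable_energy C _).sub
      ((integrable_finsetSum _ fun i _ => integrable_norm_sq _).const_mul μ)
  have hGval : ∀ k, ∫ x, G k x = (ellipticForm C).value ⟨(f k).toLp 2 volume, hW k⟩
      - μ * (laplaceForm d).value ⟨(f k).toLp 2 volume, hW k⟩ := by
    intro k
    rw [value_ellipticForm C (hW k), value_laplaceForm_eq_integral (hW k), ← integral_const_mul,
      ← integral_sub (integrable_energy C _)
        ((integrable_finsetSum _ fun i _ => integrable_norm_sq _).const_mul μ)]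
    simp only [G, M, energy_sub_smul_one]
  have hnorm : ∀ k, ‖(f k).toLp 2 volume‖ ^ 2 = ∫ x, χ x ^ 2 := by
    intro k
    rw [norm_sq_eq_integral]
    refine integral_congr_ae ?_
    filter_upwards [(f k).coeFn_toLp 2 volume] with x hx
    rw [hx, hf, norm_modulate]
  -- Integrability of the two coefficients is read off from k = 0 and k = 1.
  have ha : Integrable a := (hGint 0).congr ((hG 0).trans (by simp))
  have hq : Integrable fun x => χ x ^ 2 * q x := by
    refine ((hGint 1).sub ha).congr ?_
    filter_upwards [hG 1] with x hx
    simp [hx]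
  have hlow : ∀ k : ℝ, 0 ≤ ((∫ x, a x) + ν * ∫ x, χ x ^ 2) + k ^ 2 * ∫ x, χ x ^ 2 * q x := by
    intro k
    have h1 : ∫ x, G k x = (∫ x, a x) + k ^ 2 * ∫ x, χ x ^ 2 * q x := by
      rw [integral_congr_ae (hG k), integral_add ha (hq.const_mul _), integral_const_mul]
    have h2 := h _ (hW k)
    rw [hnorm k] at h2
    linarith [hGval k]
  change 0 ≤ ∫ x, χ x ^ 2 * q x
  by_contra! hneg
  set D := (∫ x, a x) + ν * ∫ x, χ x ^ 2
  -- This k makes the quadratic term equal to −(|D| + 1), so the lower bound would read 0 ≤ D − |D|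
  -- − 1.
  have h3 := hlow (√((|D| + 1) / -∫ x, χ x ^ 2 * q x))
  rw [Real.sq_sqrt (div_nonneg (by positivity) (neg_nonneg.2 hneg.le)), div_neg, neg_mul,
    div_mul_cancel₀ _ hneg.ne] at h3
  linarith [le_abs_self D]

/-- Gårding's inequality forces uniform ellipticity of the coefficients. -/
theorem ae_posSemidef_of_le {C : Coefficients d} {μ ν : ℝ}
    (h : ∀ φ (hφ : φ ∈ W12 d), μ * (laplaceForm d).value ⟨φ, hφ⟩ - ν * ‖φ‖ ^ 2
      ≤ (ellipticForm C).value ⟨φ, hφ⟩) :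
    ∀ᵐ x, (C.mat x - μ • (1 : Matrix (Fin d) (Fin d) ℝ)).PosSemidef := by
  -- The exceptional null set depends on ξ; a countable dense set of ξ gives a common one, and
  -- continuity in ξ does the rest.
  have h1 : ∀ᵐ x, ∀ n, 0 ≤ TopologicalSpace.denseSeq (Fin d → ℝ) n ⬝ᵥ
      (C.mat x - μ • (1 : Matrix (Fin d) (Fin d) ℝ)).mulVec
        (TopologicalSpace.denseSeq (Fin d → ℝ) n) := by
    refine ae_all_iff.2 fun n => ae_nonneg_of_integral_sq_mul_nonneg
      (memLp_top_quadratic C μ _) fun χ hχ hχc => ?_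
    exact integral_sq_mul_quadratic_nonneg h
      (WithLp.toLp 2 (TopologicalSpace.denseSeq (Fin d → ℝ) n)) hχ hχc
  filter_upwards [h1, C.posSemidef] with x hx hC
  refine Matrix.PosSemidef.of_dotProduct_mulVec_nonneg
    (hC.1.sub (Matrix.isHermitian_one.smul (IsSelfAdjoint.all μ))) fun ξ => ?_
  have hcl : IsClosed {ξ : Fin d → ℝ | 0 ≤ ξ ⬝ᵥ
      (C.mat x - μ • (1 : Matrix (Fin d) (Fin d) ℝ)).mulVec ξ} :=
    isClosed_le continuous_const (by fun_prop)
  rw [star_trivial]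
  exact hcl.closure_subset_iff.2 (Set.range_subset_iff.2 hx)
    (TopologicalSpace.denseRange_denseSeq (Fin d → ℝ) ξ)

/-! ### The individual implications -/

/-- The form inequality `a ≥ μ l - ν I`, spelled out. -/
theorem smul_sub_smul_ident_le_iff {a : Form (L2 d)} {μ ν : ℝ} :
    μ • laplaceForm d - ν • Form.ident ≤ a ↔ ∃ hd : a.domain ≤ W12 d, ∀ φ : a.domain,
      μ * (laplaceForm d).value ⟨φ, hd φ.2⟩ - ν * ‖(φ : L2 d)‖ ^ 2 ≤ a.value φ := by
  have hv : ∀ φ (hφ : φ ∈ W12 d),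
      (μ • laplaceForm d - ν • Form.ident).value ⟨φ, hφ, trivial⟩
        = μ * (laplaceForm d).value ⟨φ, hφ⟩ - ν * ‖φ‖ ^ 2 := fun φ hφ => by
    rw [Form.value_sub_form, Form.value_smul_form, Form.value_smul_form]
    exact congrArg (_ - ν * ·) (Form.value_ident _)
  constructor
  · rintro ⟨hd, h⟩
    exact ⟨fun φ hφ => (hd hφ).1, fun φ => (hv φ (hd φ.2).1).symm.trans_le (h φ)⟩
  · rintro ⟨hd, h⟩
    exact ⟨fun φ hφ => ⟨hd hφ, trivial⟩, fun φ => (hv φ (hd φ.2)).trans_le (h φ)⟩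

theorem smul_le_iff {a : Form (L2 d)} {μ : ℝ} :
    μ • laplaceForm d ≤ a ↔ ∃ hd : a.domain ≤ W12 d, ∀ φ : a.domain,
      μ * (laplaceForm d).value ⟨φ, hd φ.2⟩ ≤ a.value φ := by
  constructor
  · rintro ⟨hd, h⟩
    exact ⟨hd, fun φ => (Form.value_smul_form μ _).symm.trans_le (h φ)⟩
  · rintro ⟨hd, h⟩
    exact ⟨hd, fun φ => (Form.value_smul_form μ _).trans_le (h φ)⟩

theorem smul_sub_le_of_smul_le {a : Form (L2 d)} {μ : ℝ} (h : μ • laplaceForm d ≤ a) :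
    μ • laplaceForm d - (0 : ℝ) • Form.ident ≤ a := by
  obtain ⟨hd, h⟩ := smul_le_iff.1 h
  exact smul_sub_smul_ident_le_iff.2 ⟨hd, fun φ => by rw [zero_mul, sub_zero]; exact h φ⟩

theorem isClosed_viscosityForm (C : Coefficients d) : (viscosityForm C).IsClosed :=
  (isClosedPos_formOf _).closed

/-- The open mapping estimate l ≤ K(h + ‖·‖²) is the claim with μ = 1/K and ν = 1. -/
theorem exists_lower_bound_of_isClosed {C : Coefficients d} (h : (ellipticForm C).IsClosed) :
    ∃ μ ν : ℝ, 0 < μ ∧ 0 ≤ ν ∧ μ • laplaceForm d - ν • Form.ident ≤ ellipticForm C := by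
  obtain ⟨M, hM⟩ := exists_value_ellipticForm_le C
  obtain ⟨K, hK, hle⟩ := Form.exists_value_le (isClosedPos_ellipticForm h) isClosedPos_laplaceForm
    rfl hM
  refine ⟨K⁻¹, 1, inv_pos.2 hK, zero_le_one, smul_sub_smul_ident_le_iff.2 ⟨le_rfl, fun φ => ?_⟩⟩
  have h1 := hle φ φ.2
  rw [← inv_mul_le_iff₀ hK] at h1
  rw [one_mul]
  exact sub_le_iff_le_add.2 h1

theorem smul_laplaceForm_le {C : Coefficients d} {μ : ℝ}
    (h : ∀ᵐ x, (C.mat x - μ • (1 : Matrix (Fin d) (Fin d) ℝ)).PosSemidef) :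
    μ • laplaceForm d ≤ ellipticForm C :=
  smul_le_iff.2 ⟨le_rfl, fun φ => mul_value_laplaceForm_le h φ.2⟩

theorem ae_posSemidef_of_form_le {C : Coefficients d} {μ ν : ℝ}
    (h : μ • laplaceForm d - ν • Form.ident ≤ ellipticForm C) :
    ∀ᵐ x, (C.mat x - μ • (1 : Matrix (Fin d) (Fin d) ℝ)).PosSemidef := by
  obtain ⟨_, h⟩ := smul_sub_smul_ident_le_iff.1 h
  exact ae_posSemidef_of_le (ν := ν) fun φ hφ => h ⟨φ, hφ⟩

theorem isClosed_ellipticForm {C : Coefficients d} {μ : ℝ} (hμ : 0 < μ)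
    (h : μ • laplaceForm d ≤ ellipticForm C) : (ellipticForm C).IsClosed := by
  obtain ⟨_, h⟩ := smul_le_iff.1 h
  obtain ⟨M, hM⟩ := exists_value_ellipticForm_le C
  exact isClosedPos_laplaceForm.isClosed_of_le rfl hμ (fun φ hφ => h ⟨φ, hφ⟩) hM

theorem Form.le_trans {𝓗 : Type*} [NormedAddCommGroup 𝓗] [InnerProductSpace ℂ 𝓗]
    {a b c : Form 𝓗} (hab : a ≤ b) (hbc : b ≤ c) : a ≤ c := by
  obtain ⟨h1, h1'⟩ := hab
  obtain ⟨h2, h2'⟩ := hbc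
  exact ⟨h2.trans h1, fun φ => (h1' ⟨φ, h2 φ.2⟩).trans (h2' φ)⟩

end Viscosity

end

theorem proposition2 {d : ℕ} (C : Viscosity.Coefficients d) :
    List.TFAE [
      (Viscosity.ellipticForm C).IsClosed,
      Viscosity.ellipticForm C = Viscosity.viscosityForm C,
      ∃ μ : ℝ, 0 < μ ∧ ∀ᵐ x, (C.mat x - μ • (1 : Matrix (Fin d) (Fin d) ℝ)).PosSemidef,
      ∃ μ : ℝ, 0 < μ ∧ μ • Viscosity.laplaceForm d ≤ Viscosity.ellipticForm C,
      ∃ μ ν : ℝ, 0 < μ ∧ 0 ≤ ν ∧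
        μ • Viscosity.laplaceForm d - ν • Viscosity.Form.ident ≤ Viscosity.ellipticForm C,
      ∃ μ : ℝ, 0 < μ ∧
        μ • Viscosity.formOf (Viscosity.laplacian d)
          ≤ Viscosity.formOf (Viscosity.viscosityOperator C),
      ∃ μ ν : ℝ, 0 < μ ∧ 0 ≤ ν ∧
        μ • Viscosity.formOf (Viscosity.laplacian d) - ν • Viscosity.Form.ident
          ≤ Viscosity.formOf (Viscosity.viscosityOperator C)] := by
  -- By the representation theorem, the operator inequalities with Δ become inequalities with l.
  rw [Viscosity.formOf_laplacian]
  tfae_have 1 → 2 := Viscosity.ellipticForm_eq_viscosityForm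
  tfae_have 2 → 1 := fun h => h ▸ Viscosity.isClosed_viscosityForm C
  tfae_have 1 → 5 := Viscosity.exists_lower_bound_of_isClosed
  tfae_have 5 → 3 := fun ⟨μ, _, hμ, _, h⟩ => ⟨μ, hμ, Viscosity.ae_posSemidef_of_form_le h⟩
  tfae_have 3 → 4 := fun ⟨μ, hμ, h⟩ => ⟨μ, hμ, Viscosity.smul_laplaceForm_le h⟩
  tfae_have 4 → 1 := fun ⟨_, hμ, h⟩ => Viscosity.isClosed_ellipticForm hμ h
  tfae_have 4 → 6 := fun ⟨μ, hμ, h⟩ => ⟨μ, hμ, h.trans_eq <|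
    Viscosity.ellipticForm_eq_viscosityForm (Viscosity.isClosed_ellipticForm hμ h)⟩
  tfae_have 6 → 7 := fun ⟨μ, hμ, h⟩ => ⟨μ, 0, hμ, le_rfl, Viscosity.smul_sub_le_of_smul_le h⟩
  tfae_have 7 → 5 := fun ⟨μ, ν, hμ, hν, h⟩ =>
    ⟨μ, ν, hμ, hν, Viscosity.Form.le_trans h (Viscosity.viscosityForm_le C)⟩
  tfae_finish
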